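/- Let $(X,\mu)$ be a homogeneous space: $X$ is a metric space and $\mu$ is a nonatomic Borel measure on $X$ such that $0<\mu(B(x,r))<\infty$ and $\mu(B(x,2r))\le c_d\,\mu(B(x,r))$ for all $x\in X$, $r>0$, where $c_d$ denotes the smallest such constant; let $s=\log_2 c_d$. For a ball $B=B(x,r)$ write $r(B)=r$, $\varrho B=B(x,\varrho r)$ and $f_B=\mu(B)^{-1}\int_B f\,d\mu$. For $p,q\ge 1$, $c_P>0$, $\sigma\ge 1$ and $\Omega\subset X$, measurable functions $f$ (real-valued) and $g\ge 0$ satisfy a $p$–$q$ Poincaré inequality on $\Omega$ with constants $c_P,\sigma$ if, for every ball $B$ with $\sigma B\subset\Omega$, $f$ is integrable on $B$ and $$\Big(\frac1{\mu(B)}\int_B|f-f_B|^p\,d\mu\Big)^{1/p}\le c_P\,r(B)\Big(\frac1{\mu(\sigma B)}\int_{\sigma B}g^q\,d\mu\Big)^{1/q};$$ $f$ is then called a $p$–$q$ Sobolev function on $\Omega$ and $g$ a gradient of $f$. A rearrangement invariant (r.i.) space $Z(X)$ is a Banach function space over $(X,\mu)$ (in the sense of Bennett–Sharpley) in which functions with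 equal decreasing rearrangements have equal norms; $\|h\|_Z=\infty$ if $h\notin Z$. The associate norm is $\|v\|_{Z'}=\sup\{\int_X |uv|\,d\mu:\|u\|_Z\le 1\}$, and $\phi_{Z'}(t)=\|\chi_E\|_{Z'}$ for any measurable $E$ with $\mu(E)=t$. Write $\|f\|_0=\mu(\operatorname{supp} f)$, where $\operatorname{supp} f$ may be read either as $\{f\neq 0\}$ or as its closure. **Theorem.** There is a constant $c_2\in(0,1]$, depending only on $(X,\mu)$, such that for every ball $B_0\subset X$ and every $c_P>0$ the following hold. (i) There is a constant $c>0$, depending only on $(X,\mu)$, $B_0$ and $c_P$, such that for all $p,q,\sigma\ge1$, every measurable $f:X\to\mathbb R$ with $\operatorname{supp} f\subset B_0$ and $\|f\|_0<c_2\,\mu(B_0)$, every measurable $g:X\to[0,\infty)$ such that $f$ and $g$ satisfy a $p$–$q$ Poincaré inequality on $4\sigma B_0$ with constants $c_P,\sigma$, and every r.i. space $Z(X)$, $$\|f\|_{L^p(X)}\le c\,\big[\|g^q\|_{Z(X)}\,\phi_{Z'}(\|f\|_0)\big]^{1/q}\,\|f\|_0^{\frac{s+p}{sp}-\frac1q}.$$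 (ii) For every $q\ge 1$ with $q>s$ there is a constant $c>0$, depending only on $(X,\mu)$, $B_0$, $c_P$ and $q$, such that for all $\sigma\ge1$, every measurable $f:X\to\mathbb R$ with $\operatorname{supp} f\subset B_0$ and $\|f\|_0<c_2\,\mu(B_0)$, every measurable $g:X\to[0,\infty)$ such that $f$ and $g$ satisfy a $1$–$q$ Poincaré inequality on $4\sigma B_0$ with constants $c_P,\sigma$, and every r.i. space $Z(X)$, $$\|f\|_{L^\infty(X)}\le c\,\big[\|g^q\|_{Z(X)}\,\phi_{Z'}(\|f\|_0)\big]^{1/q}\,\|f\|_0^{\frac1s-\frac1q}.$$ (If $\|f\|_0=0$ the left-hand sides are $0$ and the inequalities are understood to hold.) -/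

import Mathlib

open MeasureTheory Metric
open scoped ENNReal NNReal

/-- A homogeneous space: all balls have positive finite measure and `μ` is doubling. -/
structure IsHomogeneousSpace {X : Type*} [MetricSpace X] [MeasurableSpace X]
    (μ : Measure X) : Prop where
  ball_pos : ∀ (x : X) (r : ℝ), 0 < r → 0 < μ (ball x r)
  ball_lt_top : ∀ (x : X) (r : ℝ), 0 < r → μ (ball x r) < ∞
  doubling : ∃ C : ℝ≥0, ∀ (x : X) (r : ℝ), 0 < r → μ (ball x (2 * r)) ≤ C * μ (ball x r)

/-- The smallest constant in the doubling condition. -/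
noncomputable def doublingConst {X : Type*} [MetricSpace X] [MeasurableSpace X]
    (μ : Measure X) : ℝ≥0 :=
  sInf {C : ℝ≥0 | ∀ (x : X) (r : ℝ), 0 < r → μ (ball x (2 * r)) ≤ C * μ (ball x r)}

/-- The dimension (doubling order) `s = log₂ c_d` of `μ`. -/
noncomputable def doublingDim {X : Type*} [MetricSpace X] [MeasurableSpace X]
    (μ : Measure X) : ℝ :=
  Real.logb 2 (doublingConst μ)

/-- `f` and `g` satisfy a `p`-`q`-Poincaré inequality on `Ω` with constants `cP` and `σ`: for every
ball `B` with `σB ⊆ Ω`, the mean value `f_B` makes sense and the inequality holds. -/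
structure SatisfiesPoincare {X : Type*} [MetricSpace X] [MeasurableSpace X]
    (μ : Measure X) (Ω : Set X) (p q cP σ : ℝ) (f : X → ℝ) (g : X → ℝ≥0) : Prop where
  aemeasurable_fun : AEMeasurable f (μ.restrict Ω)
  aemeasurable_grad : AEMeasurable g (μ.restrict Ω)
  integrableOn : ∀ (x : X) (r : ℝ), 0 < r → ball x (σ * r) ⊆ Ω → IntegrableOn f (ball x r) μ
  poincare : ∀ (x : X) (r : ℝ), 0 < r → ball x (σ * r) ⊆ Ω →
    (⨍⁻ y in ball x r, ‖f y - ⨍ z in ball x r, f z ∂μ‖ₑ ^ p ∂μ) ^ (1 / p) ≤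
      ENNReal.ofReal (cP * r) * (⨍⁻ y in ball x (σ * r), (g y : ℝ≥0∞) ^ q ∂μ) ^ (1 / q)

/-- The decreasing rearrangement `u^*(t) = inf {l : μ {u > l} ≤ t}` of a nonnegative function. -/
noncomputable def decRearrangement {X : Type*} [MeasurableSpace X] (μ : Measure X)
    (u : X → ℝ≥0∞) (t : ℝ≥0) : ℝ≥0∞ :=
  sInf {l : ℝ≥0∞ | μ {x | l < u x} ≤ t}

/-- A rearrangement invariant Banach function space over `(X, μ)`, given by its function norm on
nonnegative `μ`-measurable functions. The space itself is `{f : norm |f| < ∞}`. -/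
structure RISpace {X : Type*} [MeasurableSpace X] (μ : Measure X) where
  norm : (X → ℝ≥0∞) → ℝ≥0∞
  norm_eq_zero_iff : ∀ u, AEMeasurable u μ → (norm u = 0 ↔ u =ᵐ[μ] 0)
  norm_smul : ∀ (a : ℝ≥0) (u), AEMeasurable u μ → norm (fun x => a * u x) = a * norm u
  norm_add_le : ∀ u v, AEMeasurable u μ → AEMeasurable v μ →
    norm (fun x => u x + v x) ≤ norm u + norm v
  norm_mono : ∀ u v, AEMeasurable u μ → AEMeasurable v μ → u ≤ᵐ[μ] v → norm u ≤ norm v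
  norm_iSup : ∀ u : ℕ → X → ℝ≥0∞, (∀ n, AEMeasurable (u n) μ) →
    (∀ᵐ x ∂μ, Monotone fun n => u n x) → norm (fun x => ⨆ n, u n x) = ⨆ n, norm (u n)
  norm_indicator_lt_top : ∀ E : Set X, MeasurableSet E → μ E < ∞ →
    norm (E.indicator fun _ => 1) < ∞
  lintegral_le : ∀ E : Set X, MeasurableSet E → μ E < ∞ →
    ∃ C : ℝ≥0, ∀ u, AEMeasurable u μ → ∫⁻ x in E, u x ∂μ ≤ C * norm u
  rearrangement_invariant : ∀ u v, AEMeasurable u μ → AEMeasurable v μ →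
    decRearrangement μ u = decRearrangement μ v → norm u = norm v

/-- The norm of the associate space `Z'`: `‖v‖_{Z'} = sup {∫ u v dμ : u ≥ 0, ‖u‖_Z ≤ 1}`. -/
noncomputable def RISpace.associateNorm {X : Type*} [MeasurableSpace X] {μ : Measure X}
    (Z : RISpace μ) (v : X → ℝ≥0∞) : ℝ≥0∞ :=
  ⨆ (u : X → ℝ≥0∞) (_ : AEMeasurable u μ) (_ : Z.norm u ≤ 1), ∫⁻ x, u x * v x ∂μ

/-- The fundamental function `φ(t) = ‖χ_E‖`, `μ E = t`, of a function norm. For a rearrangement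
invariant norm all sets `E` of measure `t` give the same value, and the supremum is that value. -/
noncomputable def fundamentalFunction {X : Type*} [MeasurableSpace X] (μ : Measure X)
    (ρ : (X → ℝ≥0∞) → ℝ≥0∞) (t : ℝ≥0∞) : ℝ≥0∞ :=
  ⨆ (E : Set X) (_ : MeasurableSet E) (_ : μ E = t), ρ (E.indicator fun _ => 1)

/-- `S` is the support of `f`, in either of the two usual senses: `{f ≠ 0}` or its closure. -/
def IsSupportOf {X : Type*} [TopologicalSpace X] (S : Set X) (f : X → ℝ) : Prop :=
  S = Function.support f ∨ S = tsupport f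

open Set Filter Topology


/-! Let `S` be the support of `f`, `t = μ S` and `A = ‖g^q‖_Z φ_{Z'}(t)`. The space `Z` enters only
through Hölder's inequality on sets of measure exactly `t`: each carries at most `A` of the mass of
`g^q`. As `μ` has no atoms, a set `U` of finite measure splits into about `μ U / t` such pieces, so
`∫_U g^q ≤ A (1 + μ U / t)` (`RISpace.exists_setLIntegral_le`). The rest uses only this growth
bound, doubling and the Poincaré inequality.

For (i), call a ball `B` centred in `S` bad if `S` fills more than half of it, or if the average of
`g^q` over `σB` exceeds `2A/t`. Bad balls have measure at most `2t`, and almost every point of `S`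
is the centre of one, by Lebesgue density. Choosing nearly maximal bad radii and applying Vitali's
lemma gives disjoint bad balls of total measure `O(t)` whose fivefold enlargements are good and
cover almost all of `S` (`exists_stopped_covering`). On an enlarged ball `f` vanishes on at least
half, so its norm is controlled by its oscillation, and Poincaré bounds that by radius times
`(2A/t)^(1/q)`. Doubling bounds the radius by a multiple of `t^(1/s)`. Summing `p`-th powers
contributes `t^(1/p)`.

For (ii), fix the radius `R ~ t^(1/s)` at which every ball centred in `S` has measure at least `2t`.
On `B(x, R/2^k)` the oscillation is at most `α θ^k` with `θ = 2^(s/q - 1) < 1`, because `q > s`.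
Telescoping bounds all the averages of `f`, and a density-point argument transfers the bound to `f`
itself. -/

/-! ### Intermediate values of nonatomic measures -/

theorem measurable_cantorFunction {c : ℝ} (h0 : 0 ≤ c) (h1 : c < 1) :
    Measurable (Cardinal.cantorFunction c) := by
  refine Continuous.measurable ?_
  unfold Cardinal.cantorFunction
  refine continuous_tsum (u := fun n => c ^ n) (fun n => ?_)
    (summable_geometric_of_lt_one h0 h1) (fun n f => ?_)
  · have : (fun f : ℕ → Bool => Cardinal.cantorFunctionAux c f n) =
        (fun b : Bool => cond b (c ^ n) 0) ∘ fun f => f n := rfl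
    rw [this]
    exact continuous_of_discreteTopology.comp (continuous_apply n)
  · unfold Cardinal.cantorFunctionAux
    cases f n <;> simp [abs_of_nonneg, pow_nonneg h0, h0]

/-- Countably many separating sets code points as 0-1 sequences, and the Cantor function turns these
into reals. Pushing `μ` forward along such a map creates no point masses, which reduces the
intermediate value property to the line. -/
theorem exists_measurable_injective_real (X : Type*) [MeasurableSpace X]
    [MeasurableSpace.CountablySeparated X] :
    ∃ h : X → ℝ, Measurable h ∧ Function.Injective h := by
  obtain ⟨f, hf, hi⟩ := MeasurableSpace.measurable_injection_nat_bool_of_countablySeparated X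
  exact ⟨_, (measurable_cantorFunction (c := 1 / 3) (by norm_num) (by norm_num)).comp hf,
    (Cardinal.cantorFunction_injective (by norm_num) (by norm_num)).comp hi⟩

/-- Without point masses the distribution function is continuous, being up to a constant a primitive
of 1, so the intermediate value theorem applies. -/
theorem exists_measure_Iic_eq (ν : Measure ℝ) [IsFiniteMeasure ν] [NullSingletonClass ν]
    {t : ℝ≥0∞} (h0 : t ≠ 0) (ht : t < ν univ) : ∃ b, ν (Iic b) = t := by
  obtain ⟨a, ha⟩ : ∃ a, ν (Iic a) ≤ t := by
    have h := tendsto_measure_iInter_atBot (μ := ν) (s := fun a : ℝ => Iic a)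
      (fun _ => measurableSet_Iic.nullMeasurableSet) (fun _ _ h => Iic_subset_Iic.2 h)
      ⟨0, measure_ne_top _ _⟩
    rw [iInter_Iic_eq_empty_iff.2 (by simp), measure_empty] at h
    exact ((h.eventually (gt_mem_nhds (pos_iff_ne_zero.2 h0))).exists).imp fun _ h => h.le
  obtain ⟨b, hb⟩ : ∃ b, t ≤ ν (Iic b) :=
    (((tendsto_measure_Iic_atTop ν).eventually (lt_mem_nhds ht)).exists).imp fun _ h => h.le
  have hcont : Continuous fun b => ∫ _ in a..b, (1 : ℝ) ∂ν :=
    intervalIntegral.continuous_primitive (fun _ _ => intervalIntegrable_const) a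
  have hreal : ∀ b, a ≤ b → ν.real (Iic b) = ν.real (Iic a) + ∫ _ in a..b, (1 : ℝ) ∂ν := by
    intro b hab
    rw [intervalIntegral.integral_of_le hab, ← Iic_union_Ioc_eq_Iic hab,
      measureReal_union (by
        rw [Set.disjoint_left]; intro x hx hx'; exact absurd hx'.1 (not_lt.2 hx))
        measurableSet_Ioc]
    simp
  have htop : t ≠ ∞ := (ht.trans (measure_lt_top ν _)).ne
  rcases le_total b a with hba | hab
  · exact ⟨a, le_antisymm ha (hb.trans (measure_mono (Iic_subset_Iic.2 hba)))⟩
  · obtain ⟨c, hc, hc'⟩ := intermediate_value_Icc hab hcont.continuousOn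
      (show t.toReal - ν.real (Iic a) ∈ Icc _ _ by
        constructor
        · simp only [intervalIntegral.integral_same, sub_nonneg]
          exact ENNReal.toReal_mono htop ha
        · have := hreal b hab
          have h2 : t.toReal ≤ ν.real (Iic b) := ENNReal.toReal_mono (measure_ne_top _ _) hb
          linarith)
    refine ⟨c, ?_⟩
    have := hreal c hc.1
    rw [← ENNReal.toReal_eq_toReal_iff' (measure_ne_top _ _) htop]
    change ν.real _ = _
    simp only at hc'
    linarith

/-- A σ-finite measure without point masses takes all intermediate values. -/
theorem exists_subset_measure_eq {X : Type*} [MeasurableSpace X]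
    [MeasurableSpace.CountablySeparated X] (μ : Measure X) [NullSingletonClass μ] [SigmaFinite μ]
    {U : Set X} (hU : MeasurableSet U) {t : ℝ≥0∞} (ht : t ≤ μ U) :
    ∃ E ⊆ U, MeasurableSet E ∧ μ E = t := by
  rcases eq_or_ne t 0 with rfl | h0
  · exact ⟨∅, empty_subset _, MeasurableSet.empty, measure_empty⟩
  rcases ht.eq_or_lt with rfl | ht
  · exact ⟨U, Subset.rfl, hU, rfl⟩
  obtain ⟨V, hVm, hVU, hVt, hVf⟩ := Measure.exists_subset_measure_lt_top hU ht
  obtain ⟨h, hm, hi⟩ := exists_measurable_injective_real X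
  have : IsFiniteMeasure (μ.restrict V) := ⟨by simpa using hVf⟩
  have : NullSingletonClass ((μ.restrict V).map h) := ⟨fun x => by
    rw [Measure.map_apply hm (measurableSet_singleton x)]
    exact (subsingleton_singleton.preimage hi).measure_zero _⟩
  obtain ⟨b, hb⟩ := exists_measure_Iic_eq ((μ.restrict V).map h) h0
    (by rw [Measure.map_apply hm MeasurableSet.univ]; simpa using hVt)
  rw [Measure.map_apply hm measurableSet_Iic, Measure.restrict_apply (hm measurableSet_Iic)] at hb
  exact ⟨_, inter_subset_right.trans hVU, (hm measurableSet_Iic).inter hVm, hb⟩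

/-! ### Vitali covering with factor 5 -/

theorem exists_disjoint_ball_covering {X ι : Type*} [PseudoMetricSpace X] (T : Set ι) (x : ι → X)
    (r : ι → ℝ) (R : ℝ) (hr : ∀ i ∈ T, 0 < r i) (hR : ∀ i ∈ T, r i ≤ R) :
    ∃ u ⊆ T, u.PairwiseDisjoint (fun i => ball (x i) (r i)) ∧
      ∀ i ∈ T, ∃ j ∈ u, ball (x i) (r i) ⊆ ball (x j) (5 * r j) := by
  obtain ⟨u, hu, hd, hc⟩ := Vitali.exists_disjoint_subfamily_covering_enlargement
    (fun i => ball (x i) (r i)) T r 2 one_lt_two (fun i hi => (hr i hi).le) R hR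
    (fun i hi => nonempty_ball.2 (hr i hi))
  refine ⟨u, hu, hd, fun i hi => ?_⟩
  obtain ⟨j, hj, ⟨y, hy1, hy2⟩, h⟩ := hc i hi
  refine ⟨j, hj, ball_subset_ball' ?_⟩
  rw [mem_ball] at hy1 hy2
  have := dist_triangle_left (x i) (x j) y
  linarith

/-! ### Hölder's inequality and the growth bound for integrals -/

namespace RISpace

variable {X : Type*} [MeasurableSpace X] {μ : Measure X}

theorem norm_mul_associateNorm_ge (Z : RISpace μ) {G : X → ℝ≥0∞} (hG : AEMeasurable G μ)
    (hfin : Z.norm G ≠ ∞) (v : X → ℝ≥0∞) :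
    ∫⁻ x, G x * v x ∂μ ≤ Z.norm G * Z.associateNorm v := by
  rcases eq_or_ne (Z.norm G) 0 with h0 | h0
  · have hz := (Z.norm_eq_zero_iff G hG).1 h0
    have : ∫⁻ x, G x * v x ∂μ = 0 := by
      rw [lintegral_congr_ae (g := 0)]
      · simp
      · filter_upwards [hz] with x hx
        simp [hx]
    rw [this]; exact zero_le
  · obtain ⟨a, ha⟩ : ∃ a : ℝ≥0, (a : ℝ≥0∞) = Z.norm G := ⟨_, ENNReal.coe_toNNReal hfin⟩
    have ha0 : a ≠ 0 := by rintro rfl; exact h0 (by rw [← ha]; rfl)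
    have hn : Z.norm (fun x => (a⁻¹ : ℝ≥0) * G x) ≤ 1 := by
      rw [Z.norm_smul _ _ hG, ← ha, ← ENNReal.coe_mul, inv_mul_cancel₀ ha0, ENNReal.coe_one]
    have h := le_iSup₂_of_le (f := fun (u : X → ℝ≥0∞) (_ : AEMeasurable u μ) =>
      ⨆ (_ : Z.norm u ≤ 1), ∫⁻ x, u x * v x ∂μ) _ (hG.const_mul ((a⁻¹ : ℝ≥0) : ℝ≥0∞))
      (le_iSup_of_le hn le_rfl)
    calc ∫⁻ x, G x * v x ∂μ = a * ∫⁻ x, (a⁻¹ : ℝ≥0) * G x * v x ∂μ := by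
          simp_rw [mul_assoc]
          rw [lintegral_const_mul' _ _ ENNReal.coe_ne_top, ← mul_assoc, ← ENNReal.coe_mul,
            mul_inv_cancel₀ ha0, ENNReal.coe_one, one_mul]
      _ ≤ Z.norm G * Z.associateNorm v := by
          rw [← ha]; gcongr; exact h

/-- Pairing the indicator with itself gives `μ E`. This excludes the product `∞ * 0 = 0` in Hölder's
inequality when the norm of `G` is infinite. -/
theorem associateNorm_indicator_ne_zero (Z : RISpace μ) {E : Set X} (hE : MeasurableSet E)
    (h0 : μ E ≠ 0) (hfin : μ E ≠ ∞) : Z.associateNorm (E.indicator fun _ => 1) ≠ 0 := by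
  intro h
  have hm : AEMeasurable (E.indicator fun _ => (1 : ℝ≥0∞)) μ :=
    (measurable_const.indicator hE).aemeasurable
  have := Z.norm_mul_associateNorm_ge hm (Z.norm_indicator_lt_top E hE hfin.lt_top).ne
    (E.indicator fun _ => 1)
  rw [h, mul_zero] at this
  have h2 : ∀ x, E.indicator (fun _ => (1 : ℝ≥0∞)) x * E.indicator (fun _ => (1 : ℝ≥0∞)) x =
      E.indicator 1 x := fun x => by by_cases hx : x ∈ E <;> simp [hx]
  simp_rw [h2] at this
  rw [lintegral_indicator_one hE] at this
  exact h0 (le_antisymm this zero_le)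

/-- Hölder's inequality on a set of measure `t`. -/
theorem setLIntegral_le (Z : RISpace μ) {G : X → ℝ≥0∞} (hG : AEMeasurable G μ) {E : Set X}
    (hE : MeasurableSet E) (h0 : μ E ≠ 0) (hfin : μ E ≠ ∞) :
    ∫⁻ x in E, G x ∂μ ≤ Z.norm G * fundamentalFunction μ Z.associateNorm (μ E) := by
  have hle : Z.associateNorm (E.indicator fun _ => 1) ≤
      fundamentalFunction μ Z.associateNorm (μ E) :=
    le_iSup₂_of_le (f := fun (F : Set X) (_ : MeasurableSet F) =>
      ⨆ (_ : μ F = μ E), Z.associateNorm (F.indicator fun _ => 1)) E hE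
      (le_iSup_of_le rfl le_rfl)
  rcases eq_or_ne (Z.norm G) ∞ with h | h
  · rw [h, ENNReal.top_mul]
    · exact le_top
    · intro h'
      rw [h'] at hle
      exact Z.associateNorm_indicator_ne_zero hE h0 hfin (le_antisymm hle zero_le)
  · refine le_trans ?_ ((Z.norm_mul_associateNorm_ge hG h (E.indicator fun _ => 1)).trans
      (mul_le_mul_right hle _))
    rw [← lintegral_indicator hE]
    refine lintegral_mono fun x => ?_
    by_cases hx : x ∈ E <;> simp [hx]

end RISpace

/-- Induction peeling off a piece of measure exactly `t`. A remainder smaller than `t` is instead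
enlarged to measure `t`, since the hypothesis speaks only of sets of that measure; this is where `t
≤ μ univ` is needed. -/
theorem setLIntegral_le_nat_mul {X : Type*} [MeasurableSpace X]
    [MeasurableSpace.CountablySeparated X] {μ : Measure X} [NullSingletonClass μ] [SigmaFinite μ]
    {G : X → ℝ≥0∞} {A t : ℝ≥0∞} (htop : t ≠ ∞) (htX : t ≤ μ univ)
    (hA : ∀ E, MeasurableSet E → μ E = t → ∫⁻ x in E, G x ∂μ ≤ A) (n : ℕ) :
    ∀ U, MeasurableSet U → μ U ≤ n * t → ∫⁻ x in U, G x ∂μ ≤ n * A := by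
  induction n with
  | zero =>
    intro U hU h
    rw [setLIntegral_measure_zero _ _ (by simpa using h)]
    exact zero_le
  | succ n ih =>
    intro U hU h
    rcases le_total (μ U) t with hUt | hUt
    · have hfin : μ U ≠ ∞ := (hUt.trans_lt htop.lt_top).ne
      obtain ⟨F, hF, hFm, hFt⟩ := exists_subset_measure_eq μ hU.compl (t := t - μ U) (by
        rw [measure_compl hU hfin]; gcongr)
      have hE : μ (U ∪ F) = t := by
        rw [measure_union (disjoint_compl_right.mono_right hF) hFm, hFt, add_tsub_cancel_of_le hUt]
      calc ∫⁻ x in U, G x ∂μ ≤ ∫⁻ x in U ∪ F, G x ∂μ := lintegral_mono_set subset_union_left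
        _ ≤ A := hA _ (hU.union hFm) hE
        _ ≤ (n + 1 : ℕ) * A := by
          push_cast; rw [add_mul, one_mul]; exact le_add_self
    · obtain ⟨E, hE, hEm, hEt⟩ := exists_subset_measure_eq μ hU hUt
      have h1 : μ (U \ E) ≤ n * t := by
        rw [measure_sdiff hE hEm.nullMeasurableSet (hEt ▸ htop), hEt]
        refine tsub_le_iff_right.2 (h.trans_eq ?_)
        push_cast; ring
      rw [← lintegral_inter_add_sdiff G U hEm, inter_eq_self_of_subset_right hE]
      push_cast
      rw [add_mul, one_mul, add_comm]
      exact add_le_add (ih _ (hU.diff hEm) h1) (hA _ hEm hEt)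

theorem setLIntegral_le_mul_one_add {X : Type*} [MeasurableSpace X]
    [MeasurableSpace.CountablySeparated X] {μ : Measure X} [NullSingletonClass μ] [SigmaFinite μ]
    {G : X → ℝ≥0∞} {A t : ℝ≥0∞} (h0 : t ≠ 0) (htop : t ≠ ∞) (htX : t ≤ μ univ)
    (hA : ∀ E, MeasurableSet E → μ E = t → ∫⁻ x in E, G x ∂μ ≤ A)
    {U : Set X} (hU : MeasurableSet U) (hfin : μ U ≠ ∞) :
    ∫⁻ x in U, G x ∂μ ≤ A * (1 + μ U / t) := by
  have hd : μ U / t ≠ ∞ := ENNReal.div_ne_top hfin h0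
  set n := ⌈(μ U / t).toReal⌉₊ with hn
  have h1 : μ U / t ≤ n := by
    rw [← ENNReal.ofReal_toReal hd, ← ENNReal.ofReal_natCast]
    exact ENNReal.ofReal_le_ofReal (Nat.le_ceil _)
  have h2 : (n : ℝ≥0∞) ≤ 1 + μ U / t := by
    rw [← ENNReal.ofReal_toReal hd, ← ENNReal.ofReal_natCast, ← ENNReal.ofReal_one,
      ← ENNReal.ofReal_add zero_le_one ENNReal.toReal_nonneg]
    refine ENNReal.ofReal_le_ofReal ?_
    rw [add_comm]
    exact (Nat.ceil_lt_add_one ENNReal.toReal_nonneg).le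
  refine (setLIntegral_le_nat_mul htop htX hA n U hU ?_).trans ?_
  · exact (ENNReal.div_le_iff h0 htop).1 h1
  · rw [mul_comm]; gcongr

/-! ### Doubling, Lebesgue density and the lower measure bound -/

namespace IsHomogeneousSpace

variable {X : Type*} [MetricSpace X] [MeasurableSpace X] {μ : Measure X}

/-- The infimum defining the doubling constant is attained, because each ratio of measures is a
lower bound for the admissible constants. -/
theorem measure_ball_two_mul_le (hμ : IsHomogeneousSpace μ) (x : X) {r : ℝ} (hr : 0 < r) :
    μ (ball x (2 * r)) ≤ doublingConst μ * μ (ball x r) := by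
  have h0 := (hμ.ball_pos x r hr).ne'
  have h1 := (hμ.ball_lt_top x r hr).ne
  have h2 := (hμ.ball_lt_top x (2 * r) (by positivity)).ne
  have hd : μ (ball x (2 * r)) / μ (ball x r) ≠ ∞ := ENNReal.div_ne_top h2 h0
  have : (μ (ball x (2 * r)) / μ (ball x r)).toNNReal ≤ doublingConst μ := by
    refine le_csInf hμ.doubling fun C hC => ?_
    rw [← ENNReal.coe_le_coe, ENNReal.coe_toNNReal hd]
    exact (ENNReal.div_le_iff h0 h1).2 (hC x r hr)
  rw [← ENNReal.coe_le_coe, ENNReal.coe_toNNReal hd] at this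
  exact (ENNReal.div_le_iff h0 h1).1 this

theorem measure_ball_two_pow_mul_le (hμ : IsHomogeneousSpace μ) (x : X) {r : ℝ} (hr : 0 < r)
    (k : ℕ) : μ (ball x (2 ^ k * r)) ≤ (doublingConst μ : ℝ≥0∞) ^ k * μ (ball x r) := by
  induction k with
  | zero => simp
  | succ k ih =>
    rw [pow_succ' 2, mul_assoc]
    refine (hμ.measure_ball_two_mul_le x (by positivity)).trans ?_
    rw [pow_succ', mul_assoc]
    gcongr

theorem measure_ball_le (hμ : IsHomogeneousSpace μ) {x y : X} {r R : ℝ} (hr : 0 < r)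
    (k : ℕ) (h : R + dist x y ≤ 2 ^ k * r) :
    μ (ball x R) ≤ (doublingConst μ : ℝ≥0∞) ^ k * μ (ball y r) :=
  (measure_mono (ball_subset_ball' h)).trans (hμ.measure_ball_two_pow_mul_le y hr k)

theorem sigmaFinite (hμ : IsHomogeneousSpace μ) : SigmaFinite μ := by
  rcases isEmpty_or_nonempty X with h | ⟨⟨x⟩⟩
  · rw [Measure.eq_zero_of_isEmpty μ]
    infer_instance
  · refine ⟨⟨⟨fun n => ball x (n + 1), fun _ => trivial,
      fun n => hμ.ball_lt_top x _ (by positivity), ?_⟩⟩⟩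
    refine eq_univ_of_forall fun y => mem_iUnion.2 ?_
    obtain ⟨n, hn⟩ := exists_nat_gt (dist y x)
    exact ⟨n, mem_ball.2 (by linarith)⟩

theorem countable_of_pairwiseDisjoint_ball [OpensMeasurableSpace X] (hμ : IsHomogeneousSpace μ)
    {ι : Type*} {u : Set ι} {x : ι → X} {r : ι → ℝ} (hr : ∀ i ∈ u, 0 < r i)
    (hd : u.PairwiseDisjoint fun i => ball (x i) (r i)) : u.Countable := by
  have := hμ.sigmaFinite
  have h := Measure.countable_meas_pos_of_disjoint_iUnion (μ := μ)
    (As := fun i : u => ball (x i) (r i)) (fun i => measurableSet_ball)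
    (fun i j hij => hd i.2 j.2 (fun h => hij (Subtype.ext h)))
  have h2 : {i : u | 0 < μ (ball (x i) (r i))} = univ :=
    eq_univ_of_forall fun i => hμ.ball_pos _ _ (hr i i.2)
  rw [h2, countable_univ_iff] at h
  exact countable_coe_iff.1 h

/-- A disjoint Vitali subfamily of the balls of radius `ε / 5` is countable, as all balls have
positive measure, and its centres are `ε`-dense. -/
theorem secondCountableTopology [OpensMeasurableSpace X] (hμ : IsHomogeneousSpace μ) :
    SecondCountableTopology X := by
  refine Metric.secondCountable_of_almost_dense_set fun ε hε => ?_
  obtain ⟨u, -, hd, hc⟩ := exists_disjoint_ball_covering (univ : Set X) id (fun _ => ε / 5) (ε / 5)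
    (fun _ _ => by positivity) (fun _ _ => le_rfl)
  refine ⟨u, hμ.countable_of_pairwiseDisjoint_ball (fun _ _ => by positivity) hd, fun x => ?_⟩
  obtain ⟨y, hy, h⟩ := hc x (mem_univ x)
  have h' := h (mem_ball_self (by positivity))
  rw [mem_ball] at h'
  exact ⟨y, hy, by simp only [id] at h'; linarith⟩

theorem isLocallyFiniteMeasure (hμ : IsHomogeneousSpace μ) : IsLocallyFiniteMeasure μ :=
  ⟨fun x => ⟨ball x 1, ball_mem_nhds x one_pos, hμ.ball_lt_top x 1 one_pos⟩⟩

theorem measure_closedBall_le (hμ : IsHomogeneousSpace μ) (x : X) {r : ℝ} (hr : 0 < r) :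
    μ (closedBall x r) ≤ doublingConst μ * μ (ball x r) :=
  (measure_mono (closedBall_subset_ball (by linarith))).trans (hμ.measure_ball_two_mul_le x hr)

theorem isUnifLocDoublingMeasure (hμ : IsHomogeneousSpace μ) : IsUnifLocDoublingMeasure μ := by
  refine ⟨⟨doublingConst μ * doublingConst μ, ?_⟩⟩
  filter_upwards [self_mem_nhdsWithin] with r hr x
  have hr : 0 < r := hr
  refine (hμ.measure_closedBall_le x (by positivity)).trans ?_
  push_cast
  rw [mul_assoc]
  gcongr
  exact (hμ.measure_ball_two_mul_le x hr).trans (by gcongr; exact ball_subset_closedBall)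

theorem ae_eventually_measure_ball_lt [BorelSpace X] (hμ : IsHomogeneousSpace μ) {E : Set X}
    (hE : NullMeasurableSet E μ) :
    ∀ᵐ x ∂μ, x ∈ E → ∀ᶠ r in 𝓝[>] (0 : ℝ), μ (ball x r) < 2 * μ (E ∩ ball x r) := by
  have := hμ.secondCountableTopology
  have := hμ.isLocallyFiniteMeasure
  have := hμ.isUnifLocDoublingMeasure
  obtain ⟨F, hFE, hF, hEF⟩ := hE.exists_measurable_subset_ae_eq
  have hdens := (IsUnifLocDoublingMeasure.vitaliFamily μ 1).ae_tendsto_measure_inter_div_of_measurableSet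
    hF.compl
  filter_upwards [hdens, hEF.mem_iff] with x hx hxF hxE
  have hxF := hxF.2 hxE
  rw [indicator_of_notMem (notMem_compl_iff.2 hxF)] at hx
  have hlim := hx.comp (IsUnifLocDoublingMeasure.tendsto_closedBall_filterAt μ (K := 1)
    (fun _ : ℝ => x) id tendsto_id (by
      filter_upwards [self_mem_nhdsWithin] with r hr
      exact mem_closedBall_self (by simpa using (le_of_lt hr : (0 : ℝ) ≤ r))))
  -- The density theorem concerns closed balls; passing to open balls costs a factor `D`. Relative
  -- density of `Fᶜ` below `1 / (2 * D + 1)` in closed balls leaves it below `1 / 2` in open ones.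
  set D : ℝ≥0∞ := (doublingConst μ : ℝ≥0∞) with hD
  have hev := hlim.eventually (gt_mem_nhds (show (0 : ℝ≥0∞) < (2 * D + 1)⁻¹ by
    rw [ENNReal.inv_pos]; finiteness))
  filter_upwards [hev, self_mem_nhdsWithin] with r hr hr0
  have hr0 : 0 < r := hr0
  simp only [Function.comp, id] at hr
  have hb0 := (hμ.ball_pos x r hr0).ne'
  have hb1 := (hμ.ball_lt_top x r hr0).ne
  have hc := hμ.measure_closedBall_le x hr0
  rw [← hD] at hc
  have hcfin : μ (closedBall x r) ≠ ∞ := (hc.trans_lt (by finiteness)).ne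
  have hc0 : μ (closedBall x r) ≠ 0 := (lt_of_lt_of_le (hμ.ball_pos x r hr0)
    (measure_mono ball_subset_closedBall)).ne'
  have h1 : μ (Fᶜ ∩ ball x r) ≤ (2 * D + 1)⁻¹ * (D * μ (ball x r)) :=
    calc μ (Fᶜ ∩ ball x r) ≤ μ (Fᶜ ∩ closedBall x r) := by
          gcongr; exact ball_subset_closedBall
      _ ≤ (2 * D + 1)⁻¹ * μ (closedBall x r) := (ENNReal.div_le_iff hc0 hcfin).1 hr.le
      _ ≤ _ := by gcongr
  have h2 : μ (ball x r) ≤ μ (E ∩ ball x r) + μ (Fᶜ ∩ ball x r) := by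
    refine (measure_mono fun y hy => ?_).trans (measure_union_le _ _)
    by_cases hyF : y ∈ F
    · exact Or.inl ⟨hFE hyF, hy⟩
    · exact Or.inr ⟨hyF, hy⟩
  have h3 : 2 * μ (Fᶜ ∩ ball x r) < μ (ball x r) := by
    refine lt_of_le_of_lt (mul_le_mul_right h1 2) ?_
    have e : 2 * ((2 * D + 1)⁻¹ * (D * μ (ball x r))) = μ (ball x r) * ((2 * D) / (2 * D + 1)) := by
      rw [div_eq_mul_inv]; ring
    rw [e]
    conv_rhs => rw [← mul_one (μ (ball x r))]
    refine ENNReal.mul_lt_mul_right hb0 hb1 ?_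
    refine ENNReal.div_lt_of_lt_mul ?_
    rw [one_mul]
    exact ENNReal.lt_add_right (by finiteness) one_ne_zero
  have hE1 : μ (E ∩ ball x r) ≠ ∞ := measure_ne_top_of_subset inter_subset_right hb1
  have hF1 : μ (Fᶜ ∩ ball x r) ≠ ∞ := measure_ne_top_of_subset inter_subset_right hb1
  lift μ (ball x r) to ℝ≥0 using hb1 with m
  lift μ (E ∩ ball x r) to ℝ≥0 using hE1 with a
  lift μ (Fᶜ ∩ ball x r) to ℝ≥0 using hF1 with b
  norm_cast at *
  have h2' : (m : ℝ) ≤ a + b := by exact_mod_cast h2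
  have h3' : 2 * (b : ℝ) < m := by exact_mod_cast h3
  have : (m : ℝ) < 2 * a := by linarith
  exact_mod_cast this

theorem measureReal_ball_pos (hμ : IsHomogeneousSpace μ) (x : X) {r : ℝ} (hr : 0 < r) :
    0 < μ.real (ball x r) :=
  ENNReal.toReal_pos (hμ.ball_pos x r hr).ne' (hμ.ball_lt_top x r hr).ne

/-- Otherwise the balls `ball x ((1 / 2) ^ k)` would all be at least as large as the unit ball,
though they shrink to a null singleton. This makes the dimension `s` positive. -/
theorem one_lt_doublingConst [BorelSpace X] [NullSingletonClass μ] (hμ : IsHomogeneousSpace μ)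
    (x : X) : 1 < doublingConst μ := by
  by_contra! h
  have hk : ∀ k : ℕ, μ (ball x 1) ≤ μ (ball x ((1 / 2) ^ k)) := fun k => by
    have := hμ.measure_ball_two_pow_mul_le x (r := (1 / 2) ^ k) (by positivity) k
    rw [← mul_pow, mul_one_div_cancel two_ne_zero, one_pow] at this
    refine this.trans ?_
    calc _ ≤ (1 : ℝ≥0∞) ^ k * μ (ball x ((1 / 2) ^ k)) := by gcongr; exact_mod_cast h
      _ = _ := by simp
  have hlim := tendsto_measure_iInter_atTop (μ := μ) (s := fun k : ℕ => ball x ((1 / 2 : ℝ) ^ k))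
    (fun _ => measurableSet_ball.nullMeasurableSet)
    (fun i j hij => ball_subset_ball (pow_le_pow_of_le_one (by norm_num) (by norm_num) hij))
    ⟨0, (hμ.ball_lt_top x _ (by positivity)).ne⟩
  have hI : ⋂ k : ℕ, ball x ((1 / 2 : ℝ) ^ k) ⊆ {x} := by
    intro y hy
    rw [mem_singleton_iff, ← dist_le_zero]
    refine ge_of_tendsto' (tendsto_pow_atTop_nhds_zero_of_lt_one (r := (1 / 2 : ℝ))
      (by norm_num) (by norm_num)) fun k => (mem_ball.1 (mem_iInter.1 hy k)).le
  rw [measure_mono_null hI (measure_singleton x)] at hlim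
  exact absurd (ge_of_tendsto' hlim hk) (not_le.2 (hμ.ball_pos x 1 one_pos))

theorem doublingDim_pos [BorelSpace X] [NullSingletonClass μ] (hμ : IsHomogeneousSpace μ)
    (x : X) : 0 < doublingDim μ :=
  Real.logb_pos one_lt_two (by exact_mod_cast hμ.one_lt_doublingConst x)

theorem two_rpow_doublingDim [BorelSpace X] [NullSingletonClass μ] (hμ : IsHomogeneousSpace μ)
    (x : X) : (2 : ℝ) ^ doublingDim μ = doublingConst μ :=
  Real.rpow_logb two_pos (by norm_num)
    (lt_trans zero_lt_one (by exact_mod_cast hμ.one_lt_doublingConst x))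

/-- The constant of the lower measure bound `r ≤ K μ(B(x,r))^(1/s)` near the ball `B(x₀,r₀)`. -/
noncomputable def radiusConst (μ : Measure X) (x₀ : X) (r₀ : ℝ) : ℝ :=
  2 * r₀ * (doublingConst μ / μ.real (ball x₀ r₀)) ^ (1 / doublingDim μ)

variable [BorelSpace X] [NullSingletonClass μ] {x₀ : X} {r₀ : ℝ}

theorem radiusConst_pos (hμ : IsHomogeneousSpace μ) (h₀ : 0 < r₀) : 0 < radiusConst μ x₀ r₀ := by
  have h1 : (0 : ℝ) < doublingConst μ :=
    lt_trans zero_lt_one (by exact_mod_cast hμ.one_lt_doublingConst x₀)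
  have h2 := hμ.measureReal_ball_pos x₀ h₀
  unfold radiusConst
  positivity

/-- About `log₂ (2 * r₀ / r)` doublings of `ball x r` swallow `ball x₀ r₀`, whose centre is within
`r₀` of `x`. Rounding up costs one more factor `D`, which is built into `radiusConst`. -/
theorem rpow_div_radiusConst_le (hμ : IsHomogeneousSpace μ) (h₀ : 0 < r₀) {x : X}
    (hx : x ∈ ball x₀ r₀) {r : ℝ} (hr : 0 < r) (hr' : r ≤ 2 * r₀) :
    (r / radiusConst μ x₀ r₀) ^ doublingDim μ ≤ μ.real (ball x r) := by
  set D := (doublingConst μ : ℝ) with hD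
  have hs := hμ.doublingDim_pos x₀
  have h1 : 0 < D := lt_trans zero_lt_one (by exact_mod_cast hμ.one_lt_doublingConst x₀)
  have h2 := hμ.measureReal_ball_pos x₀ h₀
  have hq : 1 ≤ 2 * r₀ / r := (one_le_div hr).2 hr'
  set k := ⌈Real.logb 2 (2 * r₀ / r)⌉₊ with hk
  have hk1 : 2 * r₀ ≤ 2 ^ k * r := by
    rw [← div_le_iff₀ hr, ← Real.rpow_natCast, ← Real.logb_le_iff_le_rpow one_lt_two (by positivity)]
    exact Nat.le_ceil _
  have hk2 : D ^ k ≤ D * (2 * r₀ / r) ^ doublingDim μ := by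
    rw [← hμ.two_rpow_doublingDim x₀] at hD
    have : (k : ℝ) ≤ Real.logb 2 (2 * r₀ / r) + 1 :=
      (Nat.ceil_lt_add_one (Real.logb_nonneg one_lt_two hq)).le
    calc D ^ k = 2 ^ (doublingDim μ * k) := by rw [hD, Real.rpow_mul two_pos.le, Real.rpow_natCast]
      _ ≤ 2 ^ (doublingDim μ * (Real.logb 2 (2 * r₀ / r) + 1)) := by
        gcongr; norm_num
      _ = _ := by
        rw [mul_add, mul_one, Real.rpow_add two_pos, ← hD, mul_comm (doublingDim μ),
          Real.rpow_mul two_pos.le, Real.rpow_logb two_pos (by norm_num) (by positivity), mul_comm]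
  have hle : μ.real (ball x₀ r₀) ≤ D ^ k * μ.real (ball x r) := by
    have := hμ.measure_ball_le (x := x₀) (y := x) (R := r₀) hr k (by
      rw [mem_ball, dist_comm] at hx; linarith)
    have h3 := ENNReal.toReal_mono
      (by have := (hμ.ball_lt_top x r hr).ne; finiteness) this
    simpa [Measure.real] using h3
  have hm := hμ.measureReal_ball_pos x hr
  have hle2 := hle.trans (mul_le_mul_of_nonneg_right hk2 hm.le)
  have e : (r / radiusConst μ x₀ r₀) ^ doublingDim μ =
      ((2 * r₀ / r) ^ doublingDim μ)⁻¹ * (μ.real (ball x₀ r₀) / D) := by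
    have e1 : r / radiusConst μ x₀ r₀ =
        (2 * r₀ / r)⁻¹ * ((D / μ.real (ball x₀ r₀)) ^ (1 / doublingDim μ))⁻¹ := by
      unfold radiusConst
      rw [← hD]
      field_simp
    rw [e1, Real.mul_rpow (by positivity) (by positivity), Real.inv_rpow (by positivity),
      Real.inv_rpow (by positivity), ← Real.rpow_mul (by positivity), one_div_mul_cancel hs.ne',
      Real.rpow_one, inv_div]
  rw [e]
  have h5 : (0 : ℝ) < (2 * r₀ / r) ^ doublingDim μ := by positivity
  rw [inv_mul_le_iff₀ h5, div_le_iff₀ h1]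
  linarith

theorem le_radiusConst_mul (hμ : IsHomogeneousSpace μ) (h₀ : 0 < r₀) {x : X}
    (hx : x ∈ ball x₀ r₀) {r : ℝ} (hr : 0 < r) (hr' : r ≤ 2 * r₀) :
    r ≤ radiusConst μ x₀ r₀ * μ.real (ball x r) ^ (1 / doublingDim μ) := by
  have hK := hμ.radiusConst_pos (x₀ := x₀) h₀
  have hs := hμ.doublingDim_pos x₀
  have := Real.rpow_le_rpow (by positivity) (hμ.rpow_div_radiusConst_le h₀ hx hr hr')
    (one_div_pos.2 hs).le
  rw [← Real.rpow_mul (by positivity), mul_one_div_cancel hs.ne', Real.rpow_one,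
    div_le_iff₀ hK] at this
  linarith

end IsHomogeneousSpace

/-! ### Weak-type estimates and the stopped covering -/

section WeakType

variable {X : Type*} [MeasurableSpace X] {μ : Measure X}

theorem lt_of_two_mul_div_mul_lt {A t M : ℝ≥0∞} (h0 : t ≠ 0) (htop : t ≠ ∞)
    (h : 2 * A / t * M < A * (1 + M / t)) : M < t := by
  by_contra! hM
  refine absurd h (not_lt.2 ?_)
  have : 1 ≤ M / t := (ENNReal.le_div_iff_mul_le (Or.inl h0) (Or.inl htop)).2 (by simpa using hM)
  calc A * (1 + M / t) ≤ A * (M / t + M / t) := by gcongr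
    _ = 2 * A / t * M := by rw [div_eq_mul_inv, div_eq_mul_inv]; ring

/-- A finite union of the sets has measure `M` with `2 * A / t * M ≤ A * (1 + M / t)`, which forces
`M ≤ t`. The case `A = 0` is harmless: the strict inequality `hbig` then leaves no sets. -/
theorem tsum_measure_le_of_average_gt {G : X → ℝ≥0∞} {A t : ℝ≥0∞} (h0 : t ≠ 0) (htop : t ≠ ∞)
    (hA : A ≠ ∞)
    (hG : ∀ U, MeasurableSet U → μ U ≠ ∞ → ∫⁻ x in U, G x ∂μ ≤ A * (1 + μ U / t))
    {ι : Type*} {V : ι → Set X} (hV : ∀ i, MeasurableSet (V i)) (hfin : ∀ i, μ (V i) ≠ ∞)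
    (hd : Pairwise (Function.onFun Disjoint V))
    (hbig : ∀ i, 2 * A / t * μ (V i) < ∫⁻ x in V i, G x ∂μ) : ∑' i, μ (V i) ≤ t := by
  rw [ENNReal.tsum_eq_iSup_sum]
  refine iSup_le fun s => ?_
  have hU : μ (⋃ i ∈ s, V i) = ∑ i ∈ s, μ (V i) :=
    measure_biUnion_finset (fun i _ j _ hij => hd hij) (fun i _ => hV i)
  have hUfin : μ (⋃ i ∈ s, V i) ≠ ∞ := by
    rw [hU]; exact ENNReal.sum_ne_top.2 fun i _ => hfin i
  by_contra! hlt
  rw [← hU] at hlt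
  set M := μ (⋃ i ∈ s, V i)
  have h1 : 2 * A / t * M ≤ A * (1 + M / t) := by
    refine le_trans ?_ (hG _ (s.measurableSet_biUnion fun i _ => hV i) hUfin)
    rw [hU, lintegral_biUnion_finset (fun i _ j _ hij => hd hij) (fun i _ => hV i),
      Finset.mul_sum]
    exact Finset.sum_le_sum fun i _ => (hbig i).le
  have hA0 : A ≠ 0 := by
    rintro rfl
    obtain ⟨i, -⟩ : s.Nonempty := by
      rw [Finset.nonempty_iff_ne_empty]
      rintro rfl
      simp [M] at hlt
    have := (hbig i).trans_le (hG _ (hV i) (hfin i))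
    simp at this
  have h2 : 1 < M / t := (ENNReal.lt_div_iff_mul_lt (Or.inl h0) (Or.inl htop)).2 (by simpa using hlt)
  refine absurd h1 (not_le.2 ?_)
  calc A * (1 + M / t) < A * (M / t + M / t) := by
        refine ENNReal.mul_lt_mul_right hA0 hA ?_
        exact ENNReal.add_lt_add_right (ENNReal.div_ne_top hUfin h0) h2
    _ = 2 * A / t * M := by rw [div_eq_mul_inv, div_eq_mul_inv]; ring

end WeakType

namespace IsHomogeneousSpace

variable {X : Type*} [MetricSpace X] [MeasurableSpace X] [BorelSpace X] {μ : Measure X}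

/-- The balls are disjoint but their `σ`-enlargements, where the averages are large, may overlap. A
second Vitali selection among the enlargements has total measure at most `t`, and its fivefold
dilates contain all the original balls. Since a ball is never compared in measure with its
`σ`-enlargement, the constant is free of `σ`; the cube comes from `5 ≤ 2 ^ 3`. -/
theorem tsum_measure_ball_le_of_average_gt (hμ : IsHomogeneousSpace μ)
    {G : X → ℝ≥0∞} {A t : ℝ≥0∞} (h0 : t ≠ 0) (htop : t ≠ ∞) (hA : A ≠ ∞)
    (hG : ∀ U, MeasurableSet U → μ U ≠ ∞ → ∫⁻ x in U, G x ∂μ ≤ A * (1 + μ U / t))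
    {u : Set X} {r : X → ℝ} {R σ : ℝ} (hσ : 1 ≤ σ) (hr : ∀ x ∈ u, 0 < r x) (hR : ∀ x ∈ u, r x ≤ R)
    (hd : u.PairwiseDisjoint fun x => ball x (r x))
    (hbig : ∀ x ∈ u, 2 * A / t * μ (ball x (σ * r x)) < ∫⁻ y in ball x (σ * r x), G y ∂μ) :
    ∑' x : u, μ (ball (x : X) (r x)) ≤ (doublingConst μ : ℝ≥0∞) ^ 3 * t := by
  have hσ0 : 0 < σ := by linarith
  obtain ⟨J, hJu, hJd, hJc⟩ := exists_disjoint_ball_covering u id (fun x => σ * r x) (σ * R)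
    (fun x hx => mul_pos hσ0 (hr x hx)) (fun x hx => by have := hR x hx; gcongr)
  have hJ0 : ∀ x ∈ J, 0 < σ * r x := fun x hx => mul_pos hσ0 (hr x (hJu hx))
  have hcount := hμ.countable_of_pairwiseDisjoint_ball hJ0 hJd
  have hcu := hμ.countable_of_pairwiseDisjoint_ball hr hd
  have : Countable u := hcu.to_subtype
  have : Countable J := hcount.to_subtype
  have hweak := tsum_measure_le_of_average_gt h0 htop hA hG
    (V := fun x : J => ball (x : X) (σ * r x)) (fun x => measurableSet_ball)
    (fun x => (hμ.ball_lt_top _ _ (hJ0 x x.2)).ne)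
    (fun x y hxy => hJd x.2 y.2 fun h => hxy (Subtype.ext h)) (fun x => hbig x (hJu x.2))
  calc ∑' x : u, μ (ball (x : X) (r x)) = μ (⋃ x ∈ u, ball x (r x)) :=
        (measure_biUnion hcu hd fun x _ => measurableSet_ball).symm
    _ ≤ μ (⋃ x : J, ball (x : X) (5 * (σ * r x))) := by
        refine measure_mono (iUnion₂_subset fun x hx => ?_)
        obtain ⟨y, hy, hxy⟩ := hJc x hx
        refine Subset.trans (ball_subset_ball ?_) (hxy.trans
          (subset_iUnion (fun y : J => ball (y : X) (5 * (σ * r y))) ⟨y, hy⟩))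
        nlinarith [hr x hx]
    _ ≤ ∑' x : J, μ (ball (x : X) (5 * (σ * r x))) := measure_iUnion_le _
    _ ≤ ∑' x : J, (doublingConst μ : ℝ≥0∞) ^ 3 * μ (ball (x : X) (σ * r x)) := by
        refine ENNReal.tsum_le_tsum fun x => hμ.measure_ball_le (hJ0 x x.2) 3 ?_
        have := hJ0 x x.2
        rw [dist_self]; linarith
    _ ≤ (doublingConst μ : ℝ≥0∞) ^ 3 * t := by
        rw [ENNReal.tsum_mul_left]; gcongr

theorem tsum_measure_ball_le_of_density (hμ : IsHomogeneousSpace μ) {S u : Set X} {r : X → ℝ}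
    (hr : ∀ x ∈ u, 0 < r x) (hd : u.PairwiseDisjoint fun x => ball x (r x))
    (hbig : ∀ x ∈ u, μ (ball x (r x)) < 2 * μ (S ∩ ball x (r x))) :
    ∑' x : u, μ (ball (x : X) (r x)) ≤ 2 * μ S := by
  calc ∑' x : u, μ (ball (x : X) (r x)) ≤ ∑' x : u, 2 * μ.restrict S (ball (x : X) (r x)) := by
        refine ENNReal.tsum_le_tsum fun x => (hbig x x.2).le.trans_eq ?_
        rw [Measure.restrict_apply measurableSet_ball, inter_comm]
    _ = 2 * μ.restrict S (⋃ x ∈ u, ball x (r x)) := by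
        rw [ENNReal.tsum_mul_left, measure_biUnion (hμ.countable_of_pairwiseDisjoint_ball hr hd) hd
          fun x _ => measurableSet_ball]
    _ ≤ 2 * μ S := by
        refine mul_le_mul_right ?_ 2
        exact (measure_mono (subset_univ _)).trans_eq (Measure.restrict_apply_univ S)

/-- Vitali-type covering of `S` by balls that are stopped with respect to the density of `S` and
the averages of `G`. -/
theorem exists_stopped_covering (hμ : IsHomogeneousSpace μ)
    {G : X → ℝ≥0∞} {A : ℝ≥0∞} {S : Set X} (hS : NullMeasurableSet S μ) (h0 : μ S ≠ 0)
    (htop : μ S ≠ ∞) (hA : A ≠ ∞)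
    (hG : ∀ U, MeasurableSet U → μ U ≠ ∞ → ∫⁻ x in U, G x ∂μ ≤ A * (1 + μ U / μ S))
    {x₀ : X} {r₀ σ : ℝ} (hr₀ : 0 < r₀) (hσ : 1 ≤ σ) (hSB : S ⊆ ball x₀ r₀)
    (hsmall : (doublingConst μ : ℝ≥0∞) ^ 4 * (2 * μ S) < μ (ball x₀ r₀)) :
    ∃ (u : Set X) (r : X → ℝ), u.Countable ∧ u ⊆ S ∧ (∀ x ∈ u, 0 < r x) ∧
      (∀ x ∈ u, 5 * r x ≤ r₀) ∧ (∀ x ∈ u, μ (ball x (r x)) ≤ 2 * μ S) ∧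
      (∀ x ∈ u, 2 * μ (S ∩ ball x (5 * r x)) ≤ μ (ball x (5 * r x))) ∧
      (∀ x ∈ u, ∫⁻ y in ball x (σ * (5 * r x)), G y ∂μ ≤
        2 * A / μ S * μ (ball x (σ * (5 * r x)))) ∧
      ∑' x : u, μ (ball (x : X) (r x)) ≤ (2 + (doublingConst μ : ℝ≥0∞) ^ 3) * μ S ∧
      ∀ᵐ x ∂μ, x ∈ S → x ∈ ⋃ y ∈ u, ball y (5 * r y) := by
  set κ := 2 * A / μ S with hκ
  let dense (x : X) (r : ℝ) : Prop := μ (ball x r) < 2 * μ (S ∩ ball x r)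
  let big (x : X) (r : ℝ) : Prop := κ * μ (ball x (σ * r)) < ∫⁻ y in ball x (σ * r), G y ∂μ
  have hσ0 : 0 < σ := by linarith
  have hle : ∀ x r, 0 < r → (dense x r ∨ big x r) → μ (ball x r) ≤ 2 * μ S := by
    rintro x r hr (h | h)
    · exact h.le.trans (by gcongr; exact inter_subset_left)
    · have hM : μ (ball x (σ * r)) < μ S := lt_of_two_mul_div_mul_lt h0 htop (h.trans_le
        (hG _ measurableSet_ball (hμ.ball_lt_top _ _ (by positivity)).ne))
      calc μ (ball x r) ≤ μ (ball x (σ * r)) :=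
            measure_mono (ball_subset_ball (by nlinarith))
        _ ≤ μ S := hM.le
        _ ≤ 2 * μ S := le_mul_of_one_le_left' one_le_two
  -- If `5 * r > r₀`, then `2 * r₀ ≤ 2 ^ 4 * r`, so four doublings of a ball of measure at most `2 *
  -- μ S` would cover `ball x₀ r₀`, against `hsmall`.
  have hrad : ∀ x ∈ S, ∀ r, 0 < r → (dense x r ∨ big x r) → 5 * r ≤ r₀ := by
    intro x hx r hr h
    by_contra! hlt
    have hd : dist x₀ x < r₀ := by rw [dist_comm]; exact hSB hx
    have h1 := hμ.measure_ball_le (x := x₀) (y := x) (R := r₀) hr 4 (by linarith)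
    refine absurd (h1.trans ?_) (not_le.2 hsmall)
    gcongr
    exact hle x r hr h
  let bad (x : X) : Set ℝ := {r | 0 < r ∧ (dense x r ∨ big x r)}
  let T : Set X := {x | x ∈ S ∧ (bad x).Nonempty}
  -- A bad radius above half the supremum: every radius from `2 * r` on is good, in particular the
  -- Vitali radius `5 * r`.
  have hsel : ∀ x ∈ T, ∃ r ∈ bad x, ∀ r', 2 * r ≤ r' → r' ∉ bad x := by
    rintro x ⟨hxS, hne⟩
    have hbdd : BddAbove (bad x) := ⟨r₀ / 5, fun r hr => by
      have := hrad x hxS r hr.1 hr.2; linarith⟩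
    obtain ⟨r₁, hr₁⟩ := hne
    have hpos : 0 < sSup (bad x) := hr₁.1.trans_le (le_csSup hbdd hr₁)
    obtain ⟨r, hr, hlt⟩ := exists_lt_of_lt_csSup ⟨r₁, hr₁⟩ (half_lt_self hpos)
    refine ⟨r, hr, fun r' h h' => ?_⟩
    have := le_csSup hbdd h'
    linarith
  choose! r hr hgood using hsel
  obtain ⟨u, huT, hud, huc⟩ := exists_disjoint_ball_covering T id r r₀ (fun x hx => (hr x hx).1)
    (fun x hx => by have := hrad x hx.1 _ (hr x hx).1 (hr x hx).2; linarith [(hr x hx).1])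
  have hr0 : ∀ x ∈ u, 0 < r x := fun x hx => (hr x (huT hx)).1
  have hr5 : ∀ x ∈ u, 5 * r x ≤ r₀ := fun x hx =>
    hrad x (huT hx).1 _ (hr0 x hx) (hr x (huT hx)).2
  have hgood5 : ∀ x ∈ u, ¬ (dense x (5 * r x) ∨ big x (5 * r x)) := fun x hx h =>
    hgood x (huT hx) (5 * r x) (by linarith [hr0 x hx]) ⟨by linarith [hr0 x hx], h⟩
  refine ⟨u, r, hμ.countable_of_pairwiseDisjoint_ball hr0 hud, fun x hx => (huT hx).1, hr0, hr5,
    fun x hx => hle _ _ (hr0 x hx) (hr x (huT hx)).2,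
    fun x hx => not_lt.1 fun h => hgood5 x hx (Or.inl h),
    fun x hx => not_lt.1 fun h => hgood5 x hx (Or.inr h), ?_, ?_⟩
  · have h1 := hμ.tsum_measure_ball_le_of_density (S := S) (u := {x ∈ u | dense x (r x)}) (r := r)
      (fun x hx => hr0 x hx.1) (hud.subset fun x hx => hx.1) (fun x hx => hx.2)
    have h2 := hμ.tsum_measure_ball_le_of_average_gt h0 htop hA hG
      (u := {x ∈ u | big x (r x)}) (r := r) (R := r₀) hσ
      (fun x hx => hr0 x hx.1) (fun x hx => by linarith [hr0 x hx.1, hr5 x hx.1])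
      (hud.subset fun x hx => hx.1) (fun x hx => hx.2)
    have hsub : u ⊆ {x ∈ u | dense x (r x)} ∪ {x ∈ u | big x (r x)} := fun x hx =>
      (hr x (huT hx)).2.imp (fun h => ⟨hx, h⟩) (fun h => ⟨hx, h⟩)
    rw [add_mul]
    exact ((ENNReal.tsum_mono_subtype (fun x => μ (ball x (r x))) hsub).trans
      (ENNReal.tsum_union_le (fun x => μ (ball x (r x))) _ _)).trans (add_le_add h1 h2)
  -- At a density point of `S` all small radii are bad, so almost every point of `S` belongs to `T`.
  · filter_upwards [hμ.ae_eventually_measure_ball_lt hS] with x hx hxS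
    obtain ⟨ρ, hρ, hρ0⟩ := ((hx hxS).and self_mem_nhdsWithin).exists
    have hxT : x ∈ T := ⟨hxS, ρ, hρ0, Or.inl hρ⟩
    obtain ⟨y, hy, hxy⟩ := huc x hxT
    exact mem_iUnion₂.2 ⟨y, hy, hxy (mem_ball_self (hr x hxT).1)⟩

end IsHomogeneousSpace

/-! ### Local estimates and the `L^p` bound -/

/-- On `B \ S`, at least half of `B`, the function `f - a` equals `-a`. Bounding `2 ^ (1 / p)` by 2
keeps the constant independent of `p`. -/
theorem enorm_mul_measure_rpow_le {X : Type*} [MeasurableSpace X] {μ : Measure X} {S B : Set X}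
    (hS : NullMeasurableSet S μ) (hB : MeasurableSet B)
    (hSB : 2 * μ (S ∩ B) ≤ μ B) (hfin : μ B ≠ ∞) {f : X → ℝ} (hf : ∀ x ∉ S, f x = 0) (a : ℝ)
    {p : ℝ} (hp : 1 ≤ p) :
    ‖a‖ₑ * μ B ^ (1 / p) ≤
      2 * eLpNorm (fun x => f x - a) (ENNReal.ofReal p) (μ.restrict B) := by
  have hp0 : 0 < p := by linarith
  have hp1 : ENNReal.ofReal p ≠ 0 := by simpa using hp0
  have hhalf : μ B ≤ 2 * μ (B \ S) := by
    have h1 : μ B ≤ μ (S ∩ B) + μ (B \ S) := by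
      refine (measure_mono fun y hy => ?_).trans (measure_union_le _ _)
      by_cases hyS : y ∈ S
      · exact Or.inl ⟨hyS, hy⟩
      · exact Or.inr ⟨hy, hyS⟩
    have hfin' : μ (S ∩ B) ≠ ∞ := measure_ne_top_of_subset inter_subset_right hfin
    have h2 : μ (S ∩ B) ≤ μ (B \ S) := by
      have h3 : μ (S ∩ B) + μ (S ∩ B) ≤ μ (S ∩ B) + μ (B \ S) := by
        rw [← two_mul]; exact hSB.trans h1
      exact (ENNReal.add_le_add_iff_left hfin').1 h3
    calc μ B ≤ μ (S ∩ B) + μ (B \ S) := h1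
      _ ≤ μ (B \ S) + μ (B \ S) := by gcongr
      _ = 2 * μ (B \ S) := (two_mul _).symm
  have hpow : μ B ^ (1 / p) ≤ 2 * μ (B \ S) ^ (1 / p) := by
    have hp' : 1 / p ≤ 1 := by rw [div_le_one hp0]; exact hp
    calc μ B ^ (1 / p) ≤ (2 * μ (B \ S)) ^ (1 / p) := by gcongr
      _ = 2 ^ (1 / p) * μ (B \ S) ^ (1 / p) := ENNReal.mul_rpow_of_nonneg _ _ (by positivity)
      _ ≤ 2 ^ (1 : ℝ) * μ (B \ S) ^ (1 / p) := by
          gcongr; exact one_le_two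
      _ = _ := by rw [ENNReal.rpow_one]
  have hconst : ‖a‖ₑ * μ (B \ S) ^ (1 / p) =
      eLpNorm (fun x => f x - a) (ENNReal.ofReal p) (μ.restrict (B \ S)) := by
    rw [eLpNorm_congr_norm_ae (g := fun _ => a), eLpNorm_const' _ hp1 ENNReal.ofReal_ne_top,
      ENNReal.toReal_ofReal hp0.le, Measure.restrict_apply_univ]
    filter_upwards [ae_restrict_mem₀ (hB.nullMeasurableSet.diff hS)] with x hx
    rw [hf x hx.2, zero_sub, norm_neg]
  calc ‖a‖ₑ * μ B ^ (1 / p) ≤ ‖a‖ₑ * (2 * μ (B \ S) ^ (1 / p)) := by gcongr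
    _ = 2 * (‖a‖ₑ * μ (B \ S) ^ (1 / p)) := by ring
    _ ≤ _ := by
      rw [hconst]
      gcongr
      exact sdiff_subset

theorem eLpNorm_restrict_le_of_sub {X : Type*} [MeasurableSpace X] {μ : Measure X} {S B : Set X}
    (hS : NullMeasurableSet S μ) (hB : MeasurableSet B)
    (hSB : 2 * μ (S ∩ B) ≤ μ B) (hfin : μ B ≠ ∞) {f : X → ℝ} (hf : ∀ x ∉ S, f x = 0)
    (hfm : AEStronglyMeasurable f (μ.restrict B)) (a : ℝ) {p : ℝ} (hp : 1 ≤ p) :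
    eLpNorm f (ENNReal.ofReal p) (μ.restrict B) ≤
      3 * eLpNorm (fun x => f x - a) (ENNReal.ofReal p) (μ.restrict B) := by
  have hp0 : 0 < p := by linarith
  have hp1 : ENNReal.ofReal p ≠ 0 := by simpa using hp0
  have h1 : 1 ≤ ENNReal.ofReal p := by simpa using hp
  have h := eLpNorm_add_le (μ := μ.restrict B) (hfm.sub (aestronglyMeasurable_const (b := a)))
    (aestronglyMeasurable_const (b := a)) h1
  have e : (f - fun _ => a) + (fun _ => a) = f := by ext x; simp
  rw [e, eLpNorm_const' _ hp1 ENNReal.ofReal_ne_top, ENNReal.toReal_ofReal hp0.le,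
    Measure.restrict_apply_univ] at h
  refine h.trans ?_
  have h2 := enorm_mul_measure_rpow_le hS hB hSB hfin hf a hp
  calc _ ≤ eLpNorm (fun x => f x - a) (ENNReal.ofReal p) (μ.restrict B) +
      2 * eLpNorm (fun x => f x - a) (ENNReal.ofReal p) (μ.restrict B) := add_le_add le_rfl h2
    _ = _ := by ring

theorem eLpNorm_restrict_eq_laverage {X : Type*} [MeasurableSpace X] {μ : Measure X} {B : Set X}
    (h0 : μ B ≠ 0) (hfin : μ B ≠ ∞) (h : X → ℝ) {p : ℝ} (hp : 1 ≤ p) :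
    eLpNorm h (ENNReal.ofReal p) (μ.restrict B) =
      (⨍⁻ y in B, ‖h y‖ₑ ^ p ∂μ) ^ (1 / p) * μ B ^ (1 / p) := by
  have hp0 : 0 < p := by linarith
  rw [eLpNorm_eq_lintegral_rpow_enorm_toReal (by simpa using hp0) ENNReal.ofReal_ne_top,
    ENNReal.toReal_ofReal hp0.le, setLAverage_eq, ← ENNReal.mul_rpow_of_nonneg _ _ (by positivity),
    ENNReal.div_mul_cancel h0 hfin]

namespace SatisfiesPoincare

variable {X : Type*} [MetricSpace X] [MeasurableSpace X] {μ : Measure X}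
  {Ω : Set X} {p q cP σ : ℝ} {f : X → ℝ} {g : X → ℝ≥0}

theorem eLpNorm_sub_average_le (hμ : IsHomogeneousSpace μ)
    (hP : SatisfiesPoincare μ Ω p q cP σ f g) (hp : 1 ≤ p) (hq : 1 ≤ q) (hσ : 1 ≤ σ)
    {x : X} {r : ℝ} (hr : 0 < r) (hΩ : ball x (σ * r) ⊆ Ω) {κ : ℝ≥0∞}
    (hκ : ∫⁻ y in ball x (σ * r), (g y : ℝ≥0∞) ^ q ∂μ ≤ κ * μ (ball x (σ * r))) :
    eLpNorm (fun y => f y - ⨍ z in ball x r, f z ∂μ) (ENNReal.ofReal p) (μ.restrict (ball x r)) ≤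
      ENNReal.ofReal (cP * r) * κ ^ (1 / q) * μ (ball x r) ^ (1 / p) := by
  have hσr : 0 < σ * r := by positivity
  rw [eLpNorm_restrict_eq_laverage (hμ.ball_pos x r hr).ne' (hμ.ball_lt_top x r hr).ne _ hp]
  refine mul_le_mul_left ((hP.poincare x r hr hΩ).trans (mul_le_mul_right ?_ _)) _
  refine ENNReal.rpow_le_rpow ?_ (by positivity)
  rw [setLAverage_eq]
  exact ENNReal.div_le_of_le_mul hκ

theorem eLpNorm_restrict_le [OpensMeasurableSpace X] (hμ : IsHomogeneousSpace μ)
    (hP : SatisfiesPoincare μ Ω p q cP σ f g) (hp : 1 ≤ p) (hq : 1 ≤ q) (hσ : 1 ≤ σ)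
    {S : Set X} (hS : NullMeasurableSet S μ) (hf : ∀ x ∉ S, f x = 0)
    {x : X} {r : ℝ} (hr : 0 < r) (hΩ : ball x (σ * r) ⊆ Ω)
    (hdens : 2 * μ (S ∩ ball x r) ≤ μ (ball x r)) {κ : ℝ≥0∞}
    (hκ : ∫⁻ y in ball x (σ * r), (g y : ℝ≥0∞) ^ q ∂μ ≤ κ * μ (ball x (σ * r))) :
    eLpNorm f (ENNReal.ofReal p) (μ.restrict (ball x r)) ≤
      3 * (ENNReal.ofReal (cP * r) * κ ^ (1 / q) * μ (ball x r) ^ (1 / p)) :=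
  (eLpNorm_restrict_le_of_sub hS measurableSet_ball hdens (hμ.ball_lt_top x r hr).ne hf
    (hP.integrableOn x r hr hΩ).1 _ hp).trans
    (mul_le_mul_right (hP.eLpNorm_sub_average_le hμ hp hq hσ hr hΩ hκ) _)

end SatisfiesPoincare

/-- Countable subadditivity of `∫ |f|^p`: overlap of the covering sets does not matter, only the sum
of the `m i`. -/
theorem eLpNorm_le_of_countable_cover {X : Type*} [MeasurableSpace X] {μ : Measure X}
    {S : Set X} {f : X → ℝ} (hf : ∀ x ∉ S, f x = 0) {ι : Type*} [Countable ι] {B : ι → Set X}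
    (hB : ∀ i, MeasurableSet (B i)) (hcov : ∀ᵐ x ∂μ, x ∈ S → x ∈ ⋃ i, B i)
    {p : ℝ} (hp : 1 ≤ p) {a M : ℝ≥0∞} {m : ι → ℝ≥0∞}
    (hloc : ∀ i, eLpNorm f (ENNReal.ofReal p) (μ.restrict (B i)) ≤ a * m i ^ (1 / p))
    (hsum : ∑' i, m i ≤ M) :
    eLpNorm f (ENNReal.ofReal p) μ ≤ a * M ^ (1 / p) := by
  have hp0 : 0 < p := by linarith
  have hp1 : ENNReal.ofReal p ≠ 0 := by simpa using hp0
  have hloc' : ∀ i, ∫⁻ x in B i, ‖f x‖ₑ ^ p ∂μ ≤ a ^ p * m i := fun i => by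
    have := ENNReal.rpow_le_rpow (hloc i) hp0.le
    rwa [eLpNorm_eq_lintegral_rpow_enorm_toReal hp1 ENNReal.ofReal_ne_top,
      ENNReal.toReal_ofReal hp0.le, ENNReal.mul_rpow_of_nonneg _ _ hp0.le, ← ENNReal.rpow_mul,
      ← ENNReal.rpow_mul, one_div_mul_cancel hp0.ne', ENNReal.rpow_one, ENNReal.rpow_one] at this
  have hint : ∫⁻ x, ‖f x‖ₑ ^ p ∂μ ≤ a ^ p * M :=
    calc ∫⁻ x, ‖f x‖ₑ ^ p ∂μ ≤ ∫⁻ x, (⋃ i, B i).indicator (fun x => ‖f x‖ₑ ^ p) x ∂μ := by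
          refine lintegral_mono_ae ?_
          filter_upwards [hcov] with x hx
          by_cases hxS : x ∈ S
          · rw [indicator_of_mem (hx hxS)]
          · simp [hf x hxS, hp0]
      _ = ∫⁻ x in ⋃ i, B i, ‖f x‖ₑ ^ p ∂μ := lintegral_indicator (MeasurableSet.iUnion hB) _
      _ ≤ ∑' i, ∫⁻ x in B i, ‖f x‖ₑ ^ p ∂μ := lintegral_iUnion_le _ _
      _ ≤ ∑' i, a ^ p * m i := ENNReal.tsum_le_tsum hloc'
      _ ≤ a ^ p * M := by rw [ENNReal.tsum_mul_left]; gcongr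
  rw [eLpNorm_eq_lintegral_rpow_enorm_toReal hp1 ENNReal.ofReal_ne_top, ENNReal.toReal_ofReal hp0.le]
  refine (ENNReal.rpow_le_rpow hint (by positivity)).trans_eq ?_
  rw [ENNReal.mul_rpow_of_nonneg _ _ (by positivity), ← ENNReal.rpow_mul,
    mul_one_div_cancel hp0.ne', ENNReal.rpow_one]

namespace SatisfiesPoincare

variable {X : Type*} [MetricSpace X] [MeasurableSpace X] [BorelSpace X] {μ : Measure X}
  [NullSingletonClass μ] {p q cP σ : ℝ} {f : X → ℝ} {g : X → ℝ≥0}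

theorem eLpNorm_le (hμ : IsHomogeneousSpace μ) {x₀ : X} {r₀ : ℝ} (hr₀ : 0 < r₀)
    (hP : SatisfiesPoincare μ (ball x₀ (4 * σ * r₀)) p q cP σ f g) (hcP : 0 < cP)
    (hp : 1 ≤ p) (hq : 1 ≤ q) (hσ : 1 ≤ σ) {S : Set X} (hS : NullMeasurableSet S μ)
    (hf : ∀ x ∉ S, f x = 0) (hSB : S ⊆ ball x₀ r₀) (h0 : μ S ≠ 0) (htop : μ S ≠ ∞)
    (hsmall : (doublingConst μ : ℝ≥0∞) ^ 4 * (2 * μ S) < μ (ball x₀ r₀))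
    {A : ℝ≥0∞} (hA : A ≠ ∞)
    (hG : ∀ U, MeasurableSet U → μ U ≠ ∞ →
      ∫⁻ x in U, (g x : ℝ≥0∞) ^ q ∂μ ≤ A * (1 + μ U / μ S)) :
    eLpNorm f (ENNReal.ofReal p) μ ≤
      3 * (ENNReal.ofReal (cP * (5 * (IsHomogeneousSpace.radiusConst μ x₀ r₀ *
        (2 * (μ S).toReal) ^ (1 / doublingDim μ)))) * (2 * A / μ S) ^ (1 / q)) *
      ((doublingConst μ : ℝ≥0∞) ^ 3 * ((2 + (doublingConst μ : ℝ≥0∞) ^ 3) * μ S)) ^ (1 / p) := by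
  obtain ⟨u, r, hcu, huS, hr, hr5, hmeas, hdens, hκ, hsum, hcov⟩ :=
    hμ.exists_stopped_covering hS h0 htop hA hG hr₀ hσ hSB hsmall
  have : Countable u := hcu.to_subtype
  have hs := hμ.doublingDim_pos x₀
  have hK := hμ.radiusConst_pos (x₀ := x₀) hr₀
  refine eLpNorm_le_of_countable_cover hf (B := fun x : u => ball (x : X) (5 * r x))
    (m := fun x : u => μ (ball (x : X) (5 * r x)))
    (fun _ => measurableSet_ball) (by simpa only [biUnion_eq_iUnion] using hcov) hp
    (fun x => ?_) ?_
  · have hrx := hr x x.2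
    have hr5x := hr5 x x.2
    have hxB := hSB (huS x.2)
    have hΩ : ball (x : X) (σ * (5 * r x)) ⊆ ball x₀ (4 * σ * r₀) := by
      refine ball_subset_ball' ?_
      rw [mem_ball] at hxB
      nlinarith [mul_le_mul_of_nonneg_left hr5x (by linarith : (0 : ℝ) ≤ σ)]
    refine (hP.eLpNorm_restrict_le hμ hp hq hσ hS hf (by positivity) hΩ (hdens x x.2)
      (hκ x x.2)).trans ?_
    rw [← mul_assoc]
    gcongr
    -- The radius bound is applied to the stopped ball itself, whose measure is at most `2 * μ S`,
    -- rather than to its enlargement.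
    refine (hμ.le_radiusConst_mul hr₀ hxB hrx (by linarith)).trans ?_
    gcongr
    have := ENNReal.toReal_mono (by finiteness) (hmeas x x.2)
    simpa [Measure.real] using this
  · calc ∑' x : u, μ (ball (x : X) (5 * r x)) ≤
        ∑' x : u, (doublingConst μ : ℝ≥0∞) ^ 3 * μ (ball (x : X) (r x)) := by
          refine ENNReal.tsum_le_tsum fun x => hμ.measure_ball_le (hr x x.2) 3 ?_
          have := hr x x.2
          rw [dist_self]; linarith
      _ ≤ _ := by rw [ENNReal.tsum_mul_left]; gcongr

end SatisfiesPoincare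

/-! ### Telescoping averages and the `L^∞` bound -/

theorem enorm_average_sub_mul_le {X : Type*} [MeasurableSpace X] {μ : Measure X} {B : Set X}
    {f : X → ℝ} (hf : IntegrableOn f B μ) (h0 : μ B ≠ 0) (hfin : μ B ≠ ∞) (a : ℝ) :
    ‖(⨍ y in B, f y ∂μ) - a‖ₑ * μ B ≤ eLpNorm (fun y => f y - a) 1 (μ.restrict B) := by
  have hr : μ.real B ≠ 0 := (ENNReal.toReal_pos h0 hfin).ne'
  have h1 : ((⨍ y in B, f y ∂μ) - a) * μ.real B = ∫ y in B, (f y - a) ∂μ := by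
    have hc : IntegrableOn (fun _ => a) B μ := integrableOn_const hfin
    rw [integral_sub hf hc, setIntegral_const, setAverage_eq, smul_eq_mul, smul_eq_mul]
    field_simp
  have h2 : ‖μ.real B‖ₑ = μ B := by
    rw [Real.enorm_of_nonneg measureReal_nonneg, ofReal_measureReal hfin]
  rw [eLpNorm_one_eq_lintegral_enorm]
  calc ‖(⨍ y in B, f y ∂μ) - a‖ₑ * μ B = ‖((⨍ y in B, f y ∂μ) - a) * μ.real B‖ₑ := by
        rw [enorm_mul, h2]
    _ ≤ _ := by rw [h1]; exact enorm_integral_le_lintegral_enorm _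

theorem abs_le_of_geometric_increments {a : ℕ → ℝ} {α D θ : ℝ} (hα : 0 ≤ α) (hD : 0 ≤ D)
    (hθ : 0 ≤ θ) (hθ1 : θ < 1) (h0 : |a 0| ≤ 2 * α)
    (hstep : ∀ k, |a (k + 1) - a k| ≤ D * (α * θ ^ k)) (k : ℕ) :
    |a k| ≤ α * (2 + D / (1 - θ)) := by
  have h : |a k| ≤ 2 * α + D * α * ∑ j ∈ Finset.range k, θ ^ j := by
    induction k with
    | zero => simpa using h0
    | succ k ih =>
      have := abs_add_le (a (k + 1) - a k) (a k)
      rw [sub_add_cancel] at this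
      rw [Finset.sum_range_succ]
      linarith [hstep k]
  have hsum : ∑ j ∈ Finset.range k, θ ^ j ≤ (1 - θ)⁻¹ := by
    rw [← tsum_geometric_of_lt_one hθ hθ1]
    exact (summable_geometric_of_lt_one hθ hθ1).sum_le_tsum _ fun i _ => pow_nonneg hθ i
  calc |a k| ≤ 2 * α + D * α * (1 - θ)⁻¹ := h.trans (by gcongr)
    _ = _ := by rw [div_eq_mul_inv]; ring

theorem mul_measure_inter_le_eLpNorm_sub {X : Type*} [MeasurableSpace X] {μ : Measure X}
    {B : Set X} (hB : MeasurableSet B) {f : X → ℝ} (hf : IntegrableOn f B μ) {a L ε : ℝ}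
    (ha : |a| ≤ L) :
    ENNReal.ofReal ε * μ ({x | L + ε < |f x|} ∩ B) ≤
      eLpNorm (fun y => f y - a) 1 (μ.restrict B) := by
  rw [eLpNorm_one_eq_lintegral_enorm]
  have hm : AEMeasurable (fun y => ‖f y - a‖ₑ) (μ.restrict B) :=
    (hf.aemeasurable.sub_const a).enorm
  refine le_trans ?_ (mul_meas_ge_le_lintegral₀ hm (ENNReal.ofReal ε))
  rw [Measure.restrict_apply' hB]
  refine mul_le_mul_right (measure_mono (inter_subset_inter_left _ fun x hx => ?_)) _
  have hx : L + ε < |f x| := hx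
  change ENNReal.ofReal ε ≤ ‖f x - a‖ₑ
  rw [Real.enorm_eq_ofReal_abs]
  refine ENNReal.ofReal_le_ofReal ?_
  have := abs_sub_abs_le_abs_sub (f x) a
  linarith

namespace SatisfiesPoincare

variable {X : Type*} [MetricSpace X] [MeasurableSpace X] [BorelSpace X] {μ : Measure X}
  {q cP σ : ℝ} {f : X → ℝ} {g : X → ℝ≥0} {Ω : Set X}

/-- The first average is at most twice the oscillation because `f` vanishes on half of the largest
ball. Consecutive averages differ by at most the doubling constant times the oscillation, and the
increments sum geometrically. -/
theorem abs_average_le (hμ : IsHomogeneousSpace μ)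
    (hP : SatisfiesPoincare μ Ω 1 q cP σ f g) {S : Set X} (hS : NullMeasurableSet S μ)
    (hf : ∀ x ∉ S, f x = 0) {x : X} {R α θ : ℝ} (hR : 0 < R) (hσ : 1 ≤ σ)
    (hΩ : ball x (σ * R) ⊆ Ω) (hdens : 2 * μ (S ∩ ball x R) ≤ μ (ball x R))
    (hα : 0 ≤ α) (hθ : 0 ≤ θ) (hθ1 : θ < 1)
    (hosc : ∀ k : ℕ, eLpNorm (fun y => f y - ⨍ z in ball x (R / 2 ^ k), f z ∂μ) 1
      (μ.restrict (ball x (R / 2 ^ k))) ≤ ENNReal.ofReal (α * θ ^ k) * μ (ball x (R / 2 ^ k)))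
    (k : ℕ) :
    |⨍ z in ball x (R / 2 ^ k), f z ∂μ| ≤ α * (2 + doublingConst μ / (1 - θ)) := by
  have hrpos : ∀ k : ℕ, 0 < R / 2 ^ k := fun k => by positivity
  have hrle : ∀ k : ℕ, R / 2 ^ k ≤ R := fun k => div_le_self hR.le (one_le_pow₀ one_le_two)
  have hint : ∀ k : ℕ, IntegrableOn f (ball x (R / 2 ^ k)) μ := fun k =>
    hP.integrableOn x _ (hrpos k) ((ball_subset_ball (by have := hrle k; gcongr)).trans hΩ)
  refine abs_le_of_geometric_increments (a := fun k => ⨍ z in ball x (R / 2 ^ k), f z ∂μ)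
    hα (doublingConst μ).2 hθ hθ1 ?_ (fun k => ?_) k
  · have h1 := enorm_mul_measure_rpow_le hS measurableSet_ball (B := ball x (R / 2 ^ 0))
      (by simpa using hdens) (hμ.ball_lt_top x _ (hrpos 0)).ne hf
      (⨍ z in ball x (R / 2 ^ 0), f z ∂μ) le_rfl
    rw [div_one, ENNReal.rpow_one, ENNReal.ofReal_one] at h1
    have h2 := h1.trans (mul_le_mul_right (hosc 0) 2)
    rw [← mul_assoc, ENNReal.mul_le_mul_iff_left (hμ.ball_pos x _ (hrpos 0)).ne'
      (hμ.ball_lt_top x _ (hrpos 0)).ne, Real.enorm_eq_ofReal_abs,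
      ← ENNReal.ofReal_ofNat 2, ← ENNReal.ofReal_mul two_pos.le,
      ENNReal.ofReal_le_ofReal_iff (by positivity)] at h2
    simpa using h2
  · have h1 := enorm_average_sub_mul_le (hint (k + 1)) (hμ.ball_pos x _ (hrpos (k + 1))).ne'
      (hμ.ball_lt_top x _ (hrpos (k + 1))).ne (⨍ z in ball x (R / 2 ^ k), f z ∂μ)
    have hsub : ball x (R / 2 ^ (k + 1)) ⊆ ball x (R / 2 ^ k) :=
      ball_subset_ball (by gcongr; exacts [one_le_two, k.le_succ])
    have h2 : R / 2 ^ k = 2 * (R / 2 ^ (k + 1)) := by rw [pow_succ]; field_simp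
    have h3 := hμ.measure_ball_two_mul_le x (hrpos (k + 1))
    rw [← h2] at h3
    have h4 := (h1.trans (eLpNorm_mono_measure _ (Measure.restrict_mono hsub le_rfl))).trans
      ((hosc k).trans (mul_le_mul_right h3 _))
    rw [← mul_assoc, ENNReal.mul_le_mul_iff_left (hμ.ball_pos x _ (hrpos (k + 1))).ne'
      (hμ.ball_lt_top x _ (hrpos (k + 1))).ne, Real.enorm_eq_ofReal_abs,
      ← ENNReal.ofReal_coe_nnreal, mul_comm, ← ENNReal.ofReal_mul NNReal.zero_le_coe,
      ENNReal.ofReal_le_ofReal_iff (by positivity)] at h4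
    exact h4

theorem eLpNorm_top_le_of_oscillation (hμ : IsHomogeneousSpace μ)
    (hP : SatisfiesPoincare μ Ω 1 q cP σ f g) (hfm : AEMeasurable f μ) {S : Set X}
    (hS : NullMeasurableSet S μ) (hf : ∀ x ∉ S, f x = 0) {R α θ : ℝ} (hR : 0 < R) (hσ : 1 ≤ σ)
    (hα : 0 ≤ α) (hθ : 0 ≤ θ) (hθ1 : θ < 1)
    (hΩ : ∀ x ∈ S, ball x (σ * R) ⊆ Ω) (hdens : ∀ x ∈ S, 2 * μ (S ∩ ball x R) ≤ μ (ball x R))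
    (hosc : ∀ x ∈ S, ∀ k : ℕ, eLpNorm (fun y => f y - ⨍ z in ball x (R / 2 ^ k), f z ∂μ) 1
      (μ.restrict (ball x (R / 2 ^ k))) ≤ ENNReal.ofReal (α * θ ^ k) * μ (ball x (R / 2 ^ k))) :
    eLpNorm f ∞ μ ≤ ENNReal.ofReal (α * (2 + doublingConst μ / (1 - θ))) := by
  set L := α * (2 + doublingConst μ / (1 - θ)) with hL
  have hL0 : 0 ≤ L := by
    have : 0 < 1 - θ := by linarith
    positivity
  -- Near a density point of `{|f| > L + ε}` half of each small ball has `|f - f_B| ≥ ε`, since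
  -- `|f_B| ≤ L`. The mean oscillation would then stay above `ε / 2`, yet it is at most `α * θ ^ k →
  -- 0`.
  have key : ∀ ε : ℝ, 0 < ε → ∀ᵐ x ∂μ, |f x| ≤ L + ε := by
    intro ε hε
    have hE : NullMeasurableSet {x | L + ε < |f x|} μ :=
      nullMeasurableSet_lt aemeasurable_const hfm.abs
    filter_upwards [hμ.ae_eventually_measure_ball_lt hE] with x hx
    by_contra! hxE
    have hxS : x ∈ S := by
      by_contra h
      rw [hf x h, abs_zero] at hxE
      linarith
    have hlim : Tendsto (fun k : ℕ => R / 2 ^ k) atTop (𝓝[>] (0 : ℝ)) := by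
      refine tendsto_nhdsWithin_iff.2 ⟨?_, Eventually.of_forall fun k => by
        have : 0 < R / 2 ^ k := by positivity
        exact this⟩
      have := (tendsto_pow_atTop_nhds_zero_of_lt_one (r := (1 / 2 : ℝ)) (by norm_num)
        (by norm_num)).const_mul R
      simpa [div_eq_mul_inv] using this
    have hlim2 : Tendsto (fun k : ℕ => 2 * (α * θ ^ k)) atTop (𝓝 0) := by
      simpa using ((tendsto_pow_atTop_nhds_zero_of_lt_one hθ hθ1).const_mul α).const_mul 2
    obtain ⟨k, hk1, hk2⟩ :=
      ((hlim.eventually (hx hxE)).and (hlim2.eventually (gt_mem_nhds hε))).exists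
    have hrk : 0 < R / 2 ^ k := by positivity
    have hrle : R / 2 ^ k ≤ R := div_le_self hR.le (one_le_pow₀ one_le_two)
    have hint : IntegrableOn f (ball x (R / 2 ^ k)) μ :=
      hP.integrableOn x _ hrk ((ball_subset_ball (by gcongr)).trans (hΩ x hxS))
    have h1 := (mul_measure_inter_le_eLpNorm_sub measurableSet_ball hint (ε := ε)
      (hP.abs_average_le hμ hS hf hR hσ (hΩ x hxS) (hdens x hxS) hα hθ hθ1 (hosc x hxS) k)).trans
      (hosc x hxS k)
    have h2 : ENNReal.ofReal ε * μ (ball x (R / 2 ^ k)) ≤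
        ENNReal.ofReal (2 * (α * θ ^ k)) * μ (ball x (R / 2 ^ k)) :=
      calc _ ≤ ENNReal.ofReal ε * (2 * μ ({x | L + ε < |f x|} ∩ ball x (R / 2 ^ k))) := by
            gcongr
        _ = 2 * (ENNReal.ofReal ε * μ ({x | L + ε < |f x|} ∩ ball x (R / 2 ^ k))) := by ring
        _ ≤ 2 * (ENNReal.ofReal (α * θ ^ k) * μ (ball x (R / 2 ^ k))) := by gcongr
        _ = _ := by
          rw [ENNReal.ofReal_mul two_pos.le, ENNReal.ofReal_ofNat, mul_assoc]
    rw [ENNReal.mul_le_mul_iff_left (hμ.ball_pos x _ hrk).ne' (hμ.ball_lt_top x _ hrk).ne,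
      ENNReal.ofReal_le_ofReal_iff (by positivity)] at h2
    linarith
  rw [eLpNorm_exponent_top]
  refine eLpNormEssSup_le_of_ae_bound ?_
  have hall : ∀ᵐ x ∂μ, ∀ n : ℕ, |f x| ≤ L + 1 / ((n : ℝ) + 1) :=
    ae_all_iff.2 fun n => key _ (by positivity)
  filter_upwards [hall] with x hx
  have hlim := (tendsto_one_div_add_atTop_nhds_zero_nat (𝕜 := ℝ)).const_add L
  rw [add_zero] at hlim
  exact ge_of_tendsto' hlim hx

variable [NullSingletonClass μ]

theorem eLpNorm_top_le (hμ : IsHomogeneousSpace μ) {x₀ : X} {r₀ : ℝ} (hr₀ : 0 < r₀)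
    (hP : SatisfiesPoincare μ (ball x₀ (4 * σ * r₀)) 1 q cP σ f g) (hcP : 0 < cP)
    (hq : 1 ≤ q) (hsq : doublingDim μ < q) (hσ : 1 ≤ σ) (hfm : AEMeasurable f μ)
    {S : Set X} (hS : NullMeasurableSet S μ)
    (hf : ∀ x ∉ S, f x = 0) (hSB : S ⊆ ball x₀ r₀) (h0 : μ S ≠ 0) (htop : μ S ≠ ∞)
    (hsmall : (doublingConst μ : ℝ≥0∞) * (2 * μ S) ≤ μ (ball x₀ r₀))
    {A : ℝ≥0∞} (hA : A ≠ ∞)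
    (hG : ∀ U, MeasurableSet U → μ U ≠ ∞ →
      ∫⁻ x in U, (g x : ℝ≥0∞) ^ q ∂μ ≤ A * (1 + μ U / μ S)) :
    eLpNorm f ∞ μ ≤
      ENNReal.ofReal (cP * (IsHomogeneousSpace.radiusConst μ x₀ r₀ *
        (2 * (μ S).toReal) ^ (1 / doublingDim μ)) *
        (2 + doublingConst μ / (1 - 2 ^ (doublingDim μ / q - 1)))) * (2 * A / μ S) ^ (1 / q) := by
  set s := doublingDim μ with hsdef
  set K := IsHomogeneousSpace.radiusConst μ x₀ r₀ with hKdef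
  set t := (μ S).toReal with ht
  have hs := hμ.doublingDim_pos x₀
  rw [← hsdef] at hs
  have hK : 0 < K := hμ.radiusConst_pos (x₀ := x₀) hr₀
  have ht0 : 0 < t := ENNReal.toReal_pos h0 htop
  have htS : ENNReal.ofReal t = μ S := ENNReal.ofReal_toReal htop
  have hq0 : 0 < q := by linarith
  -- Chosen so that the lower bound `(R / K) ^ s` for the measure of a ball of radius `R` equals `2
  -- * t`; hence `S` fills at most half of such a ball.
  set R := K * (2 * t) ^ (1 / s) with hRdef
  have hR : 0 < R := by positivity
  have hM := hμ.measureReal_ball_pos x₀ hr₀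
  have hR2 : R ≤ 2 * r₀ := by
    have h1 := ENNReal.toReal_mono (hμ.ball_lt_top x₀ r₀ hr₀).ne hsmall
    simp only [ENNReal.toReal_mul, ENNReal.coe_toReal, ENNReal.toReal_ofNat, ← ht] at h1
    have h2 : R = 2 * r₀ * (doublingConst μ / μ.real (ball x₀ r₀) * (2 * t)) ^ (1 / s) := by
      rw [Real.mul_rpow (by positivity) (by positivity), ← mul_assoc]
      rfl
    rw [h2]
    refine mul_le_of_le_one_right (by positivity) (Real.rpow_le_one (by positivity) ?_
      (by positivity))
    rw [div_mul_eq_mul_div, div_le_one hM]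
    exact h1
  set θ : ℝ := 2 ^ (s / q - 1) with hθdef
  have hθ0 : 0 < θ := by positivity
  have hθ1 : θ < 1 := Real.rpow_lt_one_of_one_lt_of_neg one_lt_two
    (by rw [sub_neg, div_lt_one hq0]; exact hsq)
  have hκtop : (2 * A / μ S) ^ (1 / q) ≠ ∞ := ENNReal.rpow_ne_top_of_nonneg (by positivity)
    (ENNReal.div_ne_top (by finiteness) h0)
  set β := ((2 * A / μ S) ^ (1 / q)).toReal with hβ
  have hβ0 : 0 ≤ β := ENNReal.toReal_nonneg
  have hβe : ENNReal.ofReal β = (2 * A / μ S) ^ (1 / q) := ENNReal.ofReal_toReal hκtop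
  have hlow : ∀ x ∈ S, ∀ k : ℕ, ENNReal.ofReal (2 * t) ≤
      ENNReal.ofReal (2 ^ (k * s)) * μ (ball x (R / 2 ^ k)) := by
    intro x hx k
    have hrk : 0 < R / 2 ^ k := by positivity
    have h1 := hμ.rpow_div_radiusConst_le hr₀ (hSB hx) hrk
      ((div_le_self hR.le (one_le_pow₀ one_le_two)).trans hR2)
    have h2 : (R / 2 ^ k / K) ^ s = (2 ^ (k * s))⁻¹ * (2 * t) := by
      have : R / 2 ^ k / K = (2 ^ k)⁻¹ * (2 * t) ^ (1 / s) := by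
        rw [hRdef]; field_simp
      rw [this, Real.mul_rpow (by positivity) (by positivity), ← Real.rpow_mul (by positivity),
        one_div_mul_cancel hs.ne', Real.rpow_one, Real.inv_rpow (by positivity),
        Real.rpow_mul two_pos.le, Real.rpow_natCast]
    rw [← hsdef, ← hKdef, h2, inv_mul_le_iff₀ (by positivity)] at h1
    rw [← ofReal_measureReal (hμ.ball_lt_top x _ hrk).ne, ← ENNReal.ofReal_mul (by positivity)]
    exact ENNReal.ofReal_le_ofReal h1
  have hΩ : ∀ x ∈ S, ball x (σ * R) ⊆ ball x₀ (4 * σ * r₀) := fun x hx => by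
    have hx' := hSB hx
    rw [mem_ball] at hx'
    refine ball_subset_ball' ?_
    nlinarith [mul_le_mul_of_nonneg_left hR2 (by linarith : (0 : ℝ) ≤ σ)]
  have hmain := hP.eLpNorm_top_le_of_oscillation hμ hfm hS hf (α := cP * R * β) hR hσ
    (by positivity) hθ0.le hθ1 hΩ (fun x hx => ?_) (fun x hx k => ?_)
  · refine hmain.trans_eq ?_
    have : 0 < 1 - θ := by linarith
    rw [← hβe, ← ENNReal.ofReal_mul (by positivity)]
    congr 1
    ring
  · have := hlow x hx 0
    simp only [Nat.cast_zero, zero_mul, Real.rpow_zero, ENNReal.ofReal_one, one_mul, pow_zero,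
      div_one, ENNReal.ofReal_mul two_pos.le, ENNReal.ofReal_ofNat, htS] at this
    exact le_trans (by gcongr; exact inter_subset_left) this
  · have hrk : 0 < R / 2 ^ k := by positivity
    have hσr : R / 2 ^ k ≤ σ * (R / 2 ^ k) := le_mul_of_one_le_left hrk.le hσ
    set c := ENNReal.ofReal (2 ^ (k * s)) with hc
    have hc1 : 1 ≤ c := by
      rw [hc, ← ENNReal.ofReal_one]
      exact ENNReal.ofReal_le_ofReal (Real.one_le_rpow one_le_two (by positivity))
    -- At scale `k` the measure may drop below `t`, but by no more than the factor `c = 2 ^ (k *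
    -- s)`. So the term 1 in the growth bound is absorbed at the cost of `c`.
    have hκ : ∫⁻ y in ball x (σ * (R / 2 ^ k)), (g y : ℝ≥0∞) ^ q ∂μ ≤
        2 * A / μ S * c * μ (ball x (σ * (R / 2 ^ k))) := by
      refine (hG _ measurableSet_ball (hμ.ball_lt_top _ _ (hrk.trans_le hσr)).ne).trans ?_
      set M := μ (ball x (σ * (R / 2 ^ k)))
      have h1 : 1 ≤ c * M / μ S := by
        rw [ENNReal.le_div_iff_mul_le (Or.inl h0) (Or.inl htop), one_mul, ← htS]
        calc ENNReal.ofReal t ≤ ENNReal.ofReal (2 * t) := ENNReal.ofReal_le_ofReal (by linarith)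
          _ ≤ c * μ (ball x (R / 2 ^ k)) := hlow x hx k
          _ ≤ c * M := by exact mul_le_mul_right (measure_mono (ball_subset_ball hσr)) c
      calc A * (1 + M / μ S) ≤ A * (c * M / μ S + c * M / μ S) := by
            gcongr; exact le_mul_of_one_le_left' hc1
        _ = _ := by simp only [div_eq_mul_inv]; ring
    have h := hP.eLpNorm_sub_average_le hμ le_rfl hq hσ hrk
      ((ball_subset_ball (by gcongr; exact div_le_self hR.le (one_le_pow₀ one_le_two))).trans
        (hΩ x hx)) hκ
    rw [div_one 1, ENNReal.rpow_one, ENNReal.ofReal_one] at h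
    refine h.trans_eq ?_
    congr 1
    rw [ENNReal.mul_rpow_of_nonneg _ _ (by positivity), ← hβe, hc,
      ENNReal.ofReal_rpow_of_pos (by positivity), ← ENNReal.ofReal_mul hβ0,
      ← ENNReal.ofReal_mul (by positivity)]
    congr 1
    have e1 : θ ^ k = (2 ^ (k * s)) ^ (1 / q) / 2 ^ k := by
      rw [hθdef, ← Real.rpow_natCast, ← Real.rpow_mul two_pos.le, ← Real.rpow_mul two_pos.le,
        ← Real.rpow_natCast 2 k, ← Real.rpow_sub two_pos]
      congr 1
      field_simp
    rw [e1]
    ring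

end SatisfiesPoincare

/-! ### Supports, constants and the final assembly -/

theorem IsSupportOf.eq_zero_of_notMem {X : Type*} [TopologicalSpace X] {S : Set X} {f : X → ℝ}
    (h : IsSupportOf S f) : ∀ x ∉ S, f x = 0 := by
  intro x hx
  rcases h with rfl | rfl
  · exact Function.notMem_support.1 hx
  · exact image_eq_zero_of_notMem_tsupport hx

theorem IsSupportOf.nullMeasurableSet {X : Type*} [TopologicalSpace X] [MeasurableSpace X]
    [OpensMeasurableSpace X] {μ : Measure X} {S : Set X} {f : X → ℝ} (h : IsSupportOf S f)
    (hf : AEMeasurable f μ) : NullMeasurableSet S μ := by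
  rcases h with rfl | rfl
  · exact hf.nullMeasurableSet_preimage (measurableSet_singleton (0 : ℝ)).compl
  · exact (isClosed_tsupport f).measurableSet.nullMeasurableSet

theorem aemeasurable_of_restrict_of_eq_zero {X : Type*} [MeasurableSpace X] {μ : Measure X}
    {Ω : Set X} (hΩ : MeasurableSet Ω) {f : X → ℝ} (hf : AEMeasurable f (μ.restrict Ω))
    (h0 : ∀ x ∉ Ω, f x = 0) : AEMeasurable f μ := by
  have h := (aemeasurable_indicator_iff hΩ).2 hf
  rwa [indicator_eq_self.2 fun x hx => by_contra fun h => hx (h0 x h)] at h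

theorem two_mul_div_rpow_le {A t : ℝ≥0∞} {q : ℝ} (hq : 1 ≤ q) :
    (2 * A / t) ^ (1 / q) ≤ 2 * (A ^ (1 / q) * t ^ (-(1 / q))) := by
  have hq0 : 0 < q := by linarith
  have hq' : 1 / q ≤ 1 := by rw [div_le_one hq0]; exact hq
  rw [mul_div_assoc, ENNReal.mul_rpow_of_nonneg _ _ (by positivity), div_eq_mul_inv A,
    ENNReal.mul_rpow_of_nonneg _ _ (by positivity), ENNReal.inv_rpow, ← ENNReal.rpow_neg]
  gcongr
  calc (2 : ℝ≥0∞) ^ (1 / q) ≤ 2 ^ (1 : ℝ) := by gcongr; exact one_le_two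
    _ = 2 := ENNReal.rpow_one 2

theorem ofReal_mul_two_mul_toReal_rpow {t : ℝ≥0∞} (h0 : t ≠ 0) (htop : t ≠ ∞) {a s : ℝ}
    (ha : 0 ≤ a) :
    ENNReal.ofReal (a * (2 * t.toReal) ^ s) = ENNReal.ofReal (a * 2 ^ s) * t ^ s := by
  have ht := ENNReal.toReal_pos h0 htop
  rw [Real.mul_rpow two_pos.le ht.le, ← mul_assoc, ENNReal.ofReal_mul (by positivity),
    ← ENNReal.ofReal_rpow_of_pos ht, ENNReal.ofReal_toReal htop]

theorem RISpace.exists_setLIntegral_le {X : Type*} [MetricSpace X] [MeasurableSpace X]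
    [BorelSpace X] {μ : Measure X} [NullSingletonClass μ] (hμ : IsHomogeneousSpace μ)
    (Z : RISpace μ) {G : X → ℝ≥0∞} (hG : AEMeasurable G μ) {S : Set X} (h0 : μ S ≠ 0)
    (htop : μ S ≠ ∞) (U : Set X) (hU : MeasurableSet U) (hfin : μ U ≠ ∞) :
    ∫⁻ x in U, G x ∂μ ≤
      (Z.norm G * fundamentalFunction μ Z.associateNorm (μ S)) * (1 + μ U / μ S) := by
  have := hμ.secondCountableTopology
  have := hμ.sigmaFinite
  refine setLIntegral_le_mul_one_add h0 htop (measure_mono (subset_univ S)) ?_ hU hfin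
  intro E hE hES
  rw [← hES]
  exact Z.setLIntegral_le hG hE (hES ▸ h0) (hES ▸ htop)

/-- The admissible size of the support relative to the ball. -/
noncomputable def supportRatio {X : Type*} [MetricSpace X] [MeasurableSpace X]
    (μ : Measure X) : ℝ := 1 / (2 * (1 + doublingConst μ) ^ 4)

theorem supportRatio_pos {X : Type*} [MetricSpace X] [MeasurableSpace X] (μ : Measure X) :
    0 < supportRatio μ := by
  unfold supportRatio
  positivity

theorem supportRatio_le_one {X : Type*} [MetricSpace X] [MeasurableSpace X] (μ : Measure X) :
    supportRatio μ ≤ 1 := by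
  unfold supportRatio
  rw [div_le_one (by positivity)]
  have : (1 : ℝ) ≤ (1 + doublingConst μ) ^ 4 :=
    one_le_pow₀ (by linarith [(doublingConst μ).2])
  linarith

theorem doublingConst_pow_mul_lt_of_lt_supportRatio {X : Type*} [MetricSpace X]
    [MeasurableSpace X] {μ : Measure X} {S B : Set X}
    (h : μ S < ENNReal.ofReal (supportRatio μ) * μ B) :
    (doublingConst μ : ℝ≥0∞) ^ 4 * (2 * μ S) < μ B := by
  set D := doublingConst μ
  have e : ENNReal.ofReal (supportRatio μ) = (2 * (1 + (D : ℝ≥0∞)) ^ 4)⁻¹ := by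
    have h1 : supportRatio μ = ((2 * (1 + D) ^ 4 : ℝ≥0) : ℝ)⁻¹ := by
      unfold supportRatio
      push_cast
      rw [one_div]
    rw [h1, ENNReal.ofReal_inv_of_pos (by positivity), ENNReal.ofReal_coe_nnreal]
    push_cast
    rfl
  rw [e, mul_comm, ← div_eq_mul_inv, ENNReal.lt_div_iff_mul_lt (Or.inl (by positivity))
    (Or.inl (by finiteness))] at h
  refine lt_of_le_of_lt ?_ h
  calc (D : ℝ≥0∞) ^ 4 * (2 * μ S) ≤ (1 + (D : ℝ≥0∞)) ^ 4 * (2 * μ S) := by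
        gcongr; exact le_add_self
    _ = _ := by ring

/-- The powers of `μ S` combine through `(s + p) / (s * p) = 1 / s + 1 / p`. Constants at least 1
raised to `1 / p` or `1 / q` are replaced by their first powers, so the final constant is uniform in
`p`, `q` and `σ`. -/
theorem eLpNorm_le_of_rearrangementInvariant {X : Type*} [MetricSpace X] [MeasurableSpace X]
    [BorelSpace X] {μ : Measure X} [NullSingletonClass μ] (hμ : IsHomogeneousSpace μ)
    {x₀ : X} {r₀ cP p q σ : ℝ} (hr₀ : 0 < r₀) (hcP : 0 < cP) (hp : 1 ≤ p) (hq : 1 ≤ q)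
    (hσ : 1 ≤ σ) {f : X → ℝ} {g : X → ℝ≥0} (hg : AEMeasurable g μ)
    (hP : SatisfiesPoincare μ (ball x₀ (4 * σ * r₀)) p q cP σ f g) {S : Set X}
    (hS : NullMeasurableSet S μ) (hf : ∀ x ∉ S, f x = 0) (hSB : S ⊆ ball x₀ r₀)
    (h0 : μ S ≠ 0) (htop : μ S ≠ ∞)
    (hsmall : (doublingConst μ : ℝ≥0∞) ^ 4 * (2 * μ S) < μ (ball x₀ r₀)) (Z : RISpace μ)
    (hA : Z.norm (fun x => (g x : ℝ≥0∞) ^ q) *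
      fundamentalFunction μ Z.associateNorm (μ S) ≠ ∞) :
    eLpNorm f (ENNReal.ofReal p) μ ≤
      ENNReal.ofReal (3 * (cP * 5 * IsHomogeneousSpace.radiusConst μ x₀ r₀ *
        2 ^ (1 / doublingDim μ)) * 2 *
        (doublingConst μ ^ 3 * (2 + doublingConst μ ^ 3))) *
      (Z.norm (fun x => (g x : ℝ≥0∞) ^ q) *
        fundamentalFunction μ Z.associateNorm (μ S)) ^ (1 / q) *
      μ S ^ ((doublingDim μ + p) / (doublingDim μ * p) - 1 / q) := by
  have hG : AEMeasurable (fun x => (g x : ℝ≥0∞) ^ q) μ := hg.coe_nnreal_ennreal.pow_const q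
  have h := hP.eLpNorm_le hμ hr₀ hcP hp hq hσ hS hf hSB h0 htop hsmall hA
    (Z.exists_setLIntegral_le hμ hG h0 htop)
  set A := Z.norm (fun x => (g x : ℝ≥0∞) ^ q) * fundamentalFunction μ Z.associateNorm (μ S)
  set D := doublingConst μ with hD
  set s := doublingDim μ with hsdef
  set K := IsHomogeneousSpace.radiusConst μ x₀ r₀ with hKdef
  set t := μ S
  have hs : 0 < s := hμ.doublingDim_pos x₀
  have hK : 0 < K := hμ.radiusConst_pos (x₀ := x₀) hr₀
  have hp0 : 0 < p := by linarith
  have hp' : 1 / p ≤ 1 := by rw [div_le_one hp0]; exact hp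
  have hD1 : (1 : ℝ≥0∞) ≤ D := by exact_mod_cast (hμ.one_lt_doublingConst x₀).le
  set E : ℝ≥0∞ := (D : ℝ≥0∞) ^ 3 * (2 + (D : ℝ≥0∞) ^ 3) with hE
  have hE1 : 1 ≤ E := one_le_mul (one_le_pow₀ hD1) (le_add_right one_le_two)
  have hE' : ENNReal.ofReal (D ^ 3 * (2 + D ^ 3)) = E := by
    have : (D ^ 3 * (2 + D ^ 3) : ℝ) = ((D ^ 3 * (2 + D ^ 3) : ℝ≥0) : ℝ) := by push_cast; rfl
    rw [this, ENNReal.ofReal_coe_nnreal]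
    push_cast
    rfl
  have h1 : ((D : ℝ≥0∞) ^ 3 * ((2 + (D : ℝ≥0∞) ^ 3) * t)) ^ (1 / p) ≤ E * t ^ (1 / p) := by
    rw [← mul_assoc, ← hE, ENNReal.mul_rpow_of_nonneg _ _ (by positivity)]
    gcongr
    calc E ^ (1 / p) ≤ E ^ (1 : ℝ) := by gcongr
      _ = E := ENNReal.rpow_one E
  have h2 : cP * (5 * (K * (2 * t.toReal) ^ (1 / s))) =
      (cP * 5 * K) * (2 * t.toReal) ^ (1 / s) := by ring
  rw [h2, ofReal_mul_two_mul_toReal_rpow h0 htop (by positivity)] at h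
  refine h.trans ?_
  have hexp : (s + p) / (s * p) - 1 / q = 1 / s + -(1 / q) + 1 / p := by
    field_simp; ring
  have hc : ∀ W : ℝ, 0 ≤ W → ENNReal.ofReal (3 * W * 2 * (D ^ 3 * (2 + D ^ 3))) =
      3 * ENNReal.ofReal W * 2 * E := fun W hW => by
    rw [ENNReal.ofReal_mul (by positivity), hE', ENNReal.ofReal_mul (by positivity),
      ENNReal.ofReal_mul (by positivity), ENNReal.ofReal_ofNat, ENNReal.ofReal_ofNat]
  rw [hexp, ENNReal.rpow_add _ _ h0 htop, ENNReal.rpow_add _ _ h0 htop, hc _ (by positivity)]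
  calc _ ≤ 3 * (ENNReal.ofReal (cP * 5 * K * 2 ^ (1 / s)) * t ^ (1 / s) *
        (2 * (A ^ (1 / q) * t ^ (-(1 / q))))) * (E * t ^ (1 / p)) := by
        gcongr
        exact two_mul_div_rpow_le hq
    _ = _ := by ring

theorem eLpNorm_top_le_of_rearrangementInvariant {X : Type*} [MetricSpace X] [MeasurableSpace X]
    [BorelSpace X] {μ : Measure X} [NullSingletonClass μ] (hμ : IsHomogeneousSpace μ)
    {x₀ : X} {r₀ cP q σ : ℝ} (hr₀ : 0 < r₀) (hcP : 0 < cP) (hq : 1 ≤ q)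
    (hsq : doublingDim μ < q) (hσ : 1 ≤ σ) {f : X → ℝ} {g : X → ℝ≥0} (hfm : AEMeasurable f μ)
    (hg : AEMeasurable g μ)
    (hP : SatisfiesPoincare μ (ball x₀ (4 * σ * r₀)) 1 q cP σ f g) {S : Set X}
    (hS : NullMeasurableSet S μ) (hf : ∀ x ∉ S, f x = 0) (hSB : S ⊆ ball x₀ r₀)
    (h0 : μ S ≠ 0) (htop : μ S ≠ ∞)
    (hsmall : (doublingConst μ : ℝ≥0∞) ^ 4 * (2 * μ S) < μ (ball x₀ r₀)) (Z : RISpace μ)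
    (hA : Z.norm (fun x => (g x : ℝ≥0∞) ^ q) *
      fundamentalFunction μ Z.associateNorm (μ S) ≠ ∞) :
    eLpNorm f ∞ μ ≤
      ENNReal.ofReal (cP * IsHomogeneousSpace.radiusConst μ x₀ r₀ *
        (2 + doublingConst μ / (1 - 2 ^ (doublingDim μ / q - 1))) *
        2 ^ (1 / doublingDim μ) * 2) *
      (Z.norm (fun x => (g x : ℝ≥0∞) ^ q) *
        fundamentalFunction μ Z.associateNorm (μ S)) ^ (1 / q) *
      μ S ^ (1 / doublingDim μ - 1 / q) := by
  have hG : AEMeasurable (fun x => (g x : ℝ≥0∞) ^ q) μ := hg.coe_nnreal_ennreal.pow_const q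
  have hD1 : (1 : ℝ≥0∞) ≤ doublingConst μ := by
    exact_mod_cast (hμ.one_lt_doublingConst x₀).le
  have hsmall' : (doublingConst μ : ℝ≥0∞) * (2 * μ S) ≤ μ (ball x₀ r₀) := by
    refine le_trans ?_ hsmall.le
    gcongr
    exact le_self_pow₀ hD1 (by norm_num)
  have h := hP.eLpNorm_top_le hμ hr₀ hcP hq hsq hσ hfm hS hf hSB h0 htop hsmall' hA
    (Z.exists_setLIntegral_le hμ hG h0 htop)
  set A := Z.norm (fun x => (g x : ℝ≥0∞) ^ q) * fundamentalFunction μ Z.associateNorm (μ S)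
  set s := doublingDim μ with hsdef
  set K := IsHomogeneousSpace.radiusConst μ x₀ r₀ with hKdef
  set H : ℝ := 2 + doublingConst μ / (1 - 2 ^ (s / q - 1)) with hH
  have hq0 : 0 < q := by linarith
  have hK : 0 < K := hμ.radiusConst_pos (x₀ := x₀) hr₀
  have hH0 : 0 < H := by
    have : (2 : ℝ) ^ (s / q - 1) < 1 := Real.rpow_lt_one_of_one_lt_of_neg one_lt_two
      (by rw [sub_neg, div_lt_one hq0]; exact hsq)
    have : 0 < 1 - (2 : ℝ) ^ (s / q - 1) := by linarith
    positivity
  have h2 : cP * (K * (2 * (μ S).toReal) ^ (1 / s)) * H =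
      (cP * K * H) * (2 * (μ S).toReal) ^ (1 / s) := by ring
  rw [h2, ofReal_mul_two_mul_toReal_rpow h0 htop (by positivity)] at h
  refine h.trans ?_
  rw [sub_eq_add_neg (1 / s), ENNReal.rpow_add _ _ h0 htop,
    ENNReal.ofReal_mul (p := cP * K * H * 2 ^ (1 / s)) (by positivity), ENNReal.ofReal_ofNat]
  calc _ ≤ ENNReal.ofReal (cP * K * H * 2 ^ (1 / s)) * μ S ^ (1 / s) *
        (2 * (A ^ (1 / q) * μ S ^ (-(1 / q)))) := by
        gcongr
        exact two_mul_div_rpow_le hq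
    _ = _ := by ring

theorem eLpNorm_eq_zero_of_measure_eq_zero {X : Type*} [MeasurableSpace X] {μ : Measure X}
    {S : Set X} {f : X → ℝ} (hf : ∀ x ∉ S, f x = 0) (hS : μ S = 0) (p : ℝ≥0∞) :
    eLpNorm f p μ = 0 := by
  have : f =ᵐ[μ] 0 := by
    filter_upwards [measure_eq_zero_iff_ae_notMem.1 hS] with x hx using hf x hx
  rw [eLpNorm_congr_ae this, eLpNorm_zero]

theorem mul_top_rpow_mul_rpow {c q e : ℝ} (hc : 0 < c) (hq : 1 ≤ q) {t : ℝ≥0∞} (h0 : t ≠ 0)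
    (htop : t ≠ ∞) : ENNReal.ofReal c * ∞ ^ (1 / q) * t ^ e = ∞ := by
  have hq0 : 0 < q := by linarith
  rw [ENNReal.top_rpow_of_pos (by positivity), ENNReal.mul_top (by simpa using hc),
    ENNReal.top_mul]
  exact (ENNReal.rpow_pos (pos_iff_ne_zero.2 h0) htop).ne'

theorem mainTheorem4 {X : Type*} [MetricSpace X] [MeasurableSpace X] [BorelSpace X]
    (μ : Measure X) [NullSingletonClass μ] (hμ : IsHomogeneousSpace μ) :
    ∃ c₂ : ℝ, 0 < c₂ ∧ c₂ ≤ 1 ∧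
      -- part (i)
      (∀ (x₀ : X) (r₀ cP : ℝ), 0 < r₀ → 0 < cP → ∃ c : ℝ, 0 < c ∧
        ∀ p q σ : ℝ, 1 ≤ p → 1 ≤ q → 1 ≤ σ →
        ∀ (f : X → ℝ) (g : X → ℝ≥0), AEMeasurable g μ →
        SatisfiesPoincare μ (ball x₀ (4 * σ * r₀)) p q cP σ f g →
        ∀ S : Set X, IsSupportOf S f → S ⊆ ball x₀ r₀ →
        μ S < ENNReal.ofReal c₂ * μ (ball x₀ r₀) →
        ∀ Z : RISpace μ,
          eLpNorm f (ENNReal.ofReal p) μ ≤ ENNReal.ofReal c *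
            (Z.norm (fun x => (g x : ℝ≥0∞) ^ q) *
              fundamentalFunction μ Z.associateNorm (μ S)) ^ (1 / q) *
            μ S ^ ((doublingDim μ + p) / (doublingDim μ * p) - 1 / q)) ∧
      -- part (ii)
      (∀ (x₀ : X) (r₀ cP q : ℝ), 0 < r₀ → 0 < cP → 1 ≤ q → doublingDim μ < q →
        ∃ c : ℝ, 0 < c ∧ ∀ σ : ℝ, 1 ≤ σ →
        ∀ (f : X → ℝ) (g : X → ℝ≥0), AEMeasurable g μ →
        SatisfiesPoincare μ (ball x₀ (4 * σ * r₀)) 1 q cP σ f g →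
        ∀ S : Set X, IsSupportOf S f → S ⊆ ball x₀ r₀ →
        μ S < ENNReal.ofReal c₂ * μ (ball x₀ r₀) →
        ∀ Z : RISpace μ,
          eLpNorm f ∞ μ ≤ ENNReal.ofReal c *
            (Z.norm (fun x => (g x : ℝ≥0∞) ^ q) *
              fundamentalFunction μ Z.associateNorm (μ S)) ^ (1 / q) *
            μ S ^ (1 / doublingDim μ - 1 / q)) := by
  -- The Poincaré hypothesis gives measurability only on the enlarged ball; outside it `f` vanishes.
  have hfmeas : ∀ {x₀ : X} {r₀ p q cP σ : ℝ} {f : X → ℝ} {g : X → ℝ≥0} {S : Set X}, 0 < r₀ →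
      1 ≤ σ → SatisfiesPoincare μ (ball x₀ (4 * σ * r₀)) p q cP σ f g → IsSupportOf S f →
      S ⊆ ball x₀ r₀ → AEMeasurable f μ := by
    intro x₀ r₀ p q cP σ f g S hr₀ hσ hP hSf hSB
    refine aemeasurable_of_restrict_of_eq_zero measurableSet_ball hP.aemeasurable_fun
      fun x hx => hSf.eq_zero_of_notMem x fun hxS => hx (ball_subset_ball ?_ (hSB hxS))
    nlinarith
  refine ⟨supportRatio μ, supportRatio_pos μ, supportRatio_le_one μ, ?_, ?_⟩
  · intro x₀ r₀ cP hr₀ hcP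
    have hK := hμ.radiusConst_pos (x₀ := x₀) hr₀
    have hD : (0 : ℝ) < doublingConst μ :=
      lt_trans zero_lt_one (by exact_mod_cast hμ.one_lt_doublingConst x₀)
    refine ⟨3 * (cP * 5 * IsHomogeneousSpace.radiusConst μ x₀ r₀ * 2 ^ (1 / doublingDim μ)) * 2 *
      (doublingConst μ ^ 3 * (2 + doublingConst μ ^ 3)), by positivity, ?_⟩
    intro p q σ hp hq hσ f g hg hP S hSf hSB hlt Z
    have htop : μ S ≠ ∞ := measure_ne_top_of_subset hSB (hμ.ball_lt_top x₀ r₀ hr₀).ne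
    rcases eq_or_ne (μ S) 0 with h0 | h0
    · rw [eLpNorm_eq_zero_of_measure_eq_zero hSf.eq_zero_of_notMem h0]
      exact zero_le
    -- If this product is infinite, so is the right-hand side: the constant is positive and, as `0 <
    -- μ S < ∞`, no power of `μ S` vanishes.
    rcases eq_or_ne (Z.norm (fun x => (g x : ℝ≥0∞) ^ q) *
      fundamentalFunction μ Z.associateNorm (μ S)) ∞ with hA | hA
    · rw [hA, mul_top_rpow_mul_rpow (by positivity) hq h0 htop]
      exact le_top
    exact eLpNorm_le_of_rearrangementInvariant hμ hr₀ hcP hp hq hσ hg hP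
      (hSf.nullMeasurableSet (hfmeas hr₀ hσ hP hSf hSB)) hSf.eq_zero_of_notMem hSB h0 htop
      (doublingConst_pow_mul_lt_of_lt_supportRatio hlt) Z hA
  · intro x₀ r₀ cP q hr₀ hcP hq hsq
    have hK := hμ.radiusConst_pos (x₀ := x₀) hr₀
    have hpos : 0 < cP * IsHomogeneousSpace.radiusConst μ x₀ r₀ *
        (2 + doublingConst μ / (1 - 2 ^ (doublingDim μ / q - 1))) *
        2 ^ (1 / doublingDim μ) * 2 := by
      have : (2 : ℝ) ^ (doublingDim μ / q - 1) < 1 :=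
        Real.rpow_lt_one_of_one_lt_of_neg one_lt_two
          (by rw [sub_neg, div_lt_one (by linarith)]; exact hsq)
      have : 0 < 1 - (2 : ℝ) ^ (doublingDim μ / q - 1) := by linarith
      positivity
    refine ⟨_, hpos, ?_⟩
    intro σ hσ f g hg hP S hSf hSB hlt Z
    have htop : μ S ≠ ∞ := measure_ne_top_of_subset hSB (hμ.ball_lt_top x₀ r₀ hr₀).ne
    rcases eq_or_ne (μ S) 0 with h0 | h0
    · rw [eLpNorm_eq_zero_of_measure_eq_zero hSf.eq_zero_of_notMem h0]
      exact zero_le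
    rcases eq_or_ne (Z.norm (fun x => (g x : ℝ≥0∞) ^ q) *
      fundamentalFunction μ Z.associateNorm (μ S)) ∞ with hA | hA
    · rw [hA, mul_top_rpow_mul_rpow hpos hq h0 htop]
      exact le_top
    have hfm := hfmeas hr₀ hσ hP hSf hSB
    exact eLpNorm_top_le_of_rearrangementInvariant hμ hr₀ hcP hq hsq hσ hfm hg hP
      (hSf.nullMeasurableSet hfm) hSf.eq_zero_of_notMem hSB h0 htop
      (doublingConst_pow_mul_lt_of_lt_supportRatio hlt) Z hA
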